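/- **Model.** An *impact function* is a continuous, strictly increasing $h:\mathbb R\to\mathbb R$ with $h(0)=0$ such that $x\mapsto xh(x)$ is convex. Let $(P^0_t)_{t\ge0}$ be a càdlàg martingale on a filtered probability space $(\Omega,\mathcal F,(\mathcal F_t),\mathbb P)$ with $\mathcal F_0$ $\mathbb P$-trivial, let $\gamma>0$, $\alpha\in[0,1]$, $\kappa\ge 0$, and let $h,\beta$ be impact functions. Let $0<\tau_1<\tau_2<\cdots\to\infty$ ($\mathbb P$-a.s.) be the random arrival times, and $\widetilde Y_1,\widetilde Y_2,\ldots\in(0,\infty]$ the random sizes, of incoming dark-pool orders. Let $N_t=\max\{k:\tau_k\le t\}$. For $\widehat X\in\mathbb R$ and $\Xi\in[0,|\widehat X|]$ put recursively $$Y_i=\operatorname{sgn}(\widehat X)\,\min\Big(\widetilde Y_i,\ |\widehat X|-\sum_{j<i}|Y_j|\Big)\ \text{ if }\widetilde Y_i\ge\Xi,\qquad Y_i=0\ \text{ otherwise},\qquad Z_t=\sum_{i=1}^{N_t}Y_i,$$ and let $(\mathcal G_t)$ be the right-continuous filtration generated by $(\mathcal F_t)$, $Z$ and the processes $(\tau_i\wedge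 t)_{t\ge 0}$, $i\ge1$. Assume that $\inf_{0<\delta\le1}\frac1\delta\mathbb P[\tau_1\le\delta]>0$, that $\inf_{\delta>0}\mathbb P[\widetilde Y_1\ge x\mid\tau_1\le\delta]>0$ for all $x>0$, and that $P^0$ is a $(\mathcal G_t)$-martingale for every choice of $\widehat X$ and $\Xi$. **Strategies and costs.** For $X_0\in\mathbb R$ and $T>0$, the class $\mathcal X(X_0,T)$ of admissible strategies consists of all $\chi=(\widehat X,\Xi,\xi,\rho)$ with $\widehat X\in\mathbb R$, $\Xi\in[0,|\widehat X|]$, $\rho$ a $(\mathcal G_t)$-stopping time with $\rho<T$ a.s., and $\xi$ a $(\mathcal G_t)$-predictable process that is a.s. integrable over $[0,T]$, for which $\int_0^t\xi_s\,ds$ is a.s. bounded uniformly in $t\in[0,T]$ and $\omega$, and $X_0+\int_0^T\xi_t\,dt+Z_\rho=0$ a.s. With $P^\chi_t=P^0_t+\gamma\int_0^t\xi_s\,ds+h(\xi_t)$, $\widehat P^\chi_{\tau_i}=P^0_{\tau_i}+\gamma\int_0^{\tau_i}\xi_s\,ds+\kappa h(\xi_{\tau_i})$ and $Z^\rho_t=Z_{\rho\wedge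 t}$, the costs of $\chi$ are $$\mathcal C^\chi_T=X_0P^0_0+\int_0^T\xi_tP^\chi_t\,dt+\alpha\gamma\int_0^TZ^\rho_t\xi_t\,dt+\sum_{i=1}^{N_\rho}Y_i\big(\widehat P^\chi_{\tau_i}+\alpha\gamma Z_{\tau_i-}+\beta(Y_i)\big)\in(-\infty,\infty]\quad\text{a.s.}$$ Expectations are taken in $[-\infty,\infty]$; $\mathbb E[\mathcal C^\chi_T]$ *exists* if the positive or the negative part of $\mathcal C^\chi_T$ has finite expectation, and statements about $\mathbb E[\mathcal C^\chi_T]$ refer to strategies for which it exists. Strictly higher expected revenues means strictly lower expected costs. **Regularity notions.** Call $\chi$ *sell-only* if $\widehat X\le0$ and a.s. $\xi_t\le0$ for all $t\in[0,T]$, and *buy-only* if $\widehat X\ge0$ and a.s. $\xi_t\ge0$ for all $t\in[0,T]$. * There is *transaction-triggered price manipulation* if there are $X_0\in\mathbb R$, $T>0$ and $\chi\in\mathcal X(X_0,T)$ such that $\mathbb E[\mathcal C^\chi_T]$ exists and either (i) $X_0\ge0$, $\chi$ is not sell-only, and for all sell-only $\chi'\in\mathcal X(X_0,T)$ the expectation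 $\mathbb E[\mathcal C^{\chi'}_T]$ exists and $\mathbb E[\mathcal C^\chi_T]<\mathbb E[\mathcal C^{\chi'}_T]$; or (ii) $X_0\le0$, $\chi$ is not buy-only, and the same holds for all buy-only $\chi'\in\mathcal X(X_0,T)$. * The model has *nonnegative expected liquidation costs* if $\mathbb E[\mathcal C^\chi_T]\ge0$ for all $X_0\in\mathbb R$, $T>0$ and all $\chi\in\mathcal X(X_0,T)$ for which $\mathbb E[\mathcal C^\chi_T]$ exists. * There is *price manipulation* if there are $T>0$ and $\chi\in\mathcal X(0,T)$ such that $\mathbb E[\mathcal C^\chi_T]$ exists and is $<0$. **Proposition.** (a) If there is no transaction-triggered price manipulation, then the model has nonnegative expected liquidation costs. (b) If the model has nonnegative expected liquidation costs, then there is no price manipulation. -/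

import Mathlib

open MeasureTheory ProbabilityTheory Filter Topology
open scoped NNReal ENNReal

noncomputable section

/-! ### Impact functions and extended integrals -/

/-- An impact function: continuous, strictly increasing, vanishing at `0`, with `x * h x` convex. -/
structure IsImpactFunction (h : ℝ → ℝ) : Prop where
  continuous : Continuous h
  strictMono : StrictMono h
  map_zero : h 0 = 0
  convexOn : ConvexOn ℝ Set.univ (fun x => x * h x)

/-- The integral of an extended-real function: integral of the positive part minus integral of the
negative part, with value in `[-∞, ∞]`. It is meaningful when one of the two parts is finite
(`HasExtIntegral`). -/
def extIntegral {α : Type*} [MeasurableSpace α] (μ : Measure α) (f : α → EReal) : EReal :=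
  ((∫⁻ x, (f x).toENNReal ∂μ : ℝ≥0∞) : EReal) - ((∫⁻ x, (-f x).toENNReal ∂μ : ℝ≥0∞) : EReal)

/-- The integral of `f` exists in `[-∞, ∞]`: it is not of the form `∞ - ∞`. -/
def HasExtIntegral {α : Type*} [MeasurableSpace α] (μ : Measure α) (f : α → EReal) : Prop :=
  (∫⁻ x, (f x).toENNReal ∂μ) ≠ ∞ ∨ (∫⁻ x, (-f x).toENNReal ∂μ) ≠ ∞

/-! ### Execution of a dark-pool order, path by path

Arrival times and sizes of the incoming orders are indexed from `0`, so that `τ i` and `y i` belong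
to the `(i + 1)`-st incoming order. The size `∞` is allowed. -/

/-- Number of shares of the dark-pool order of size `|xhat|` that are executed against an incoming
order of size `y`, when the minimum quantity level is `q` and `s` shares have been executed before.
-/
def fillStep (xhat q : ℝ) (y : ℝ≥0∞) (s : ℝ) : ℝ :=
  if ENNReal.ofReal q ≤ y then (min y (ENNReal.ofReal (|xhat| - s))).toReal else 0

/-- Number of shares executed against the first `n` incoming orders. -/
def cumFill (xhat q : ℝ) (y : ℕ → ℝ≥0∞) : ℕ → ℝ
  | 0 => 0
  | n + 1 => cumFill xhat q y n + fillStep xhat q (y n) (cumFill xhat q y n)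

/-- The signed part of the incoming order `i` that is executed against the remainder of `xhat`. -/
def fill (xhat q : ℝ) (y : ℕ → ℝ≥0∞) (i : ℕ) : ℝ :=
  Real.sign xhat * fillStep xhat q (y i) (cumFill xhat q y i)

/-- The counting process of the arrival times: the number of arrivals up to time `t`. -/
def arrivalCount (τ : ℕ → ℝ≥0) (t : ℝ≥0) : ℕ := Set.ncard {i : ℕ | τ i ≤ t}

/-- The amount `Z t` of shares executed in the dark pool until time `t`. -/
def darkFilled (xhat q : ℝ) (τ : ℕ → ℝ≥0) (y : ℕ → ℝ≥0∞) (t : ℝ≥0) : ℝ :=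
  ∑ i ∈ Finset.range (arrivalCount τ t), fill xhat q y i

theorem measurable_cumFill (xhat q : ℝ) (n : ℕ) : Measurable (fun y => cumFill xhat q y n) := by
  induction n with
  | zero => exact measurable_const
  | succ n ih =>
    refine ih.add (Measurable.ite ?_ ?_ measurable_const)
    · exact measurableSet_le measurable_const (measurable_pi_apply n)
    · exact ((measurable_pi_apply n).min
        (ENNReal.measurable_ofReal.comp (measurable_const.sub ih))).ennreal_toReal

theorem measurable_fill (xhat q : ℝ) (i : ℕ) : Measurable (fun y => fill xhat q y i) := by
  refine measurable_const.mul (Measurable.ite ?_ ?_ measurable_const)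
  · exact measurableSet_le measurable_const (measurable_pi_apply i)
  · exact ((measurable_pi_apply i).min (ENNReal.measurable_ofReal.comp
      (measurable_const.sub (measurable_cumFill xhat q i)))).ennreal_toReal

theorem measurable_arrivalCount (t : ℝ≥0) : Measurable (fun τ => arrivalCount τ t) := by
  refine measurable_ncard.comp (measurable_set_iff.2 fun i => ?_)
  exact measurableSet_setOfPred.1 (measurableSet_le (measurable_pi_apply i) measurable_const)

theorem measurable_darkFilled {Ω : Type*} [MeasurableSpace Ω] (xhat q : ℝ)
    {τ : ℕ → Ω → ℝ≥0} {y : ℕ → Ω → ℝ≥0∞} (hτ : ∀ i, Measurable (τ i)) (hy : ∀ i, Measurable (y i))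
    (t : ℝ≥0) : Measurable (fun ω => darkFilled xhat q (fun i => τ i ω) (fun i => y i ω) t) := by
  have h1 : Measurable (fun ω => arrivalCount (fun i => τ i ω) t) :=
    (measurable_arrivalCount t).comp (measurable_pi_lambda _ hτ)
  have h2 : Measurable (fun p : ℕ × Ω =>
      ∑ i ∈ Finset.range p.1, fill xhat q (fun i => y i p.2) i) := by
    refine measurable_from_prod_countable_right fun n => ?_
    have h3 : ∀ i, Measurable (fun ω => fill xhat q (fun j => y j ω) i) := fun i =>
      (measurable_fill xhat q i).comp (measurable_pi_lambda _ hy)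
    exact Finset.measurable_sum (Finset.range n) fun i _ => h3 i
  exact h2.comp (h1.prodMk measurable_id)

/-! ### The model -/

/-- The filtration generated by `F`, the dark-pool executions `Z` of the order `(xhat, q)`, and the
processes `min (τ i) t`, before passing to the right-continuous version. -/
def rawTradingFiltration {Ω : Type*} [mΩ : MeasurableSpace Ω] (F : Filtration ℝ≥0 mΩ)
    (τ : ℕ → Ω → ℝ≥0) (y : ℕ → Ω → ℝ≥0∞) (hτ : ∀ i, Measurable (τ i)) (hy : ∀ i, Measurable (y i))
    (xhat q : ℝ) : Filtration ℝ≥0 mΩ where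
  seq t := F t
    ⊔ (⨆ s ≤ t, MeasurableSpace.comap
        (fun ω => darkFilled xhat q (fun i => τ i ω) (fun i => y i ω) s) inferInstance)
    ⊔ (⨆ i : ℕ, ⨆ s ≤ t, MeasurableSpace.comap (fun ω => min (τ i ω) s) inferInstance)
  mono' _ _ hst := sup_le_sup
    (sup_le_sup (F.mono hst) (biSup_mono fun _ h => h.trans hst))
    (iSup_mono fun _ => biSup_mono fun _ h => h.trans hst)
  le' t := sup_le
    (sup_le (F.le t) (iSup₂_le fun s _ => (measurable_darkFilled xhat q hτ hy s).comap_le))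
    (iSup_le fun i => iSup₂_le fun _ _ => ((hτ i).min measurable_const).comap_le)

/-- The right-continuous filtration generated by `F`, `Z` and the processes `min (τ i) t`. -/
def tradingFiltration {Ω : Type*} [mΩ : MeasurableSpace Ω] (F : Filtration ℝ≥0 mΩ)
    (τ : ℕ → Ω → ℝ≥0) (y : ℕ → Ω → ℝ≥0∞) (hτ : ∀ i, Measurable (τ i)) (hy : ∀ i, Measurable (y i))
    (xhat q : ℝ) : Filtration ℝ≥0 mΩ :=
  (rawTradingFiltration F τ y hτ hy xhat q).rightCont

/-- An Almgren–Chriss model: a càdlàg martingale `price` (the unaffected price) with respect to a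
filtration with trivial initial σ-algebra, a permanent-impact parameter `γ > 0` and a
temporary-impact function `h`. -/
structure AlmgrenChrissModel (Ω : Type*) [mΩ : MeasurableSpace Ω] (P : Measure Ω) where
  F : Filtration ℝ≥0 mΩ
  F_zero_trivial : ∀ A, MeasurableSet[F 0] A → P A = 0 ∨ P A = 1
  price : ℝ≥0 → Ω → ℝ
  price_martingale : Martingale price F P
  price_rightCont : ∀ ω t, ContinuousWithinAt (fun s => price s ω) (Set.Ici t) t
  price_leftLim : ∀ ω t, ∃ l, Tendsto (fun s => price s ω) (𝓝[<] t) (𝓝 l)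
  γ : ℝ
  γ_pos : 0 < γ
  h : ℝ → ℝ
  h_impact : IsImpactFunction h

/-- The dark-pool extension of an Almgren–Chriss model. Here `τ i` is the arrival time and `y i` the
size of the `(i + 1)`-st incoming matching order. -/
structure DarkPoolModel (Ω : Type*) [mΩ : MeasurableSpace Ω] (P : Measure Ω) extends
    AlmgrenChrissModel Ω P where
  α : ℝ
  α_nonneg : 0 ≤ α
  α_le_one : α ≤ 1
  β : ℝ → ℝ
  β_impact : IsImpactFunction β
  κ : ℝ
  κ_nonneg : 0 ≤ κ
  τ : ℕ → Ω → ℝ≥0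
  y : ℕ → Ω → ℝ≥0∞
  τ_measurable : ∀ i, Measurable (τ i)
  y_measurable : ∀ i, Measurable (y i)
  τ_pos : ∀ᵐ ω ∂P, 0 < τ 0 ω
  τ_strictMono : ∀ᵐ ω ∂P, StrictMono (fun i => τ i ω)
  /-- Only finitely many orders arrive in finite time, so that the counting process is finite. -/
  τ_tendsto : ∀ᵐ ω ∂P, Tendsto (fun i => τ i ω) atTop atTop
  y_pos : ∀ i, ∀ᵐ ω ∂P, 0 < y i ω
  intensity_pos :
    0 < ⨅ δ : Set.Ioc (0 : ℝ) 1, (1 / (δ : ℝ)) * P.real {ω | (τ 0 ω : ℝ) ≤ (δ : ℝ)}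
  size_pos : ∀ x : ℝ, 0 < x →
    0 < ⨅ δ : Set.Ioi (0 : ℝ),
      (P[|{ω | (τ 0 ω : ℝ) ≤ (δ : ℝ)}]).real {ω | ENNReal.ofReal x ≤ y 0 ω}
  price_martingale_trading : ∀ xhat q : ℝ, 0 ≤ q → q ≤ |xhat| →
    Martingale price (tradingFiltration F τ y τ_measurable y_measurable xhat q) P

/-- A quadruple `(xhat, q, ξ, ρ)`: size of the dark-pool order, minimum quantity level, trading
speed at the exchange, cancellation time of the dark-pool order. -/
structure Strategy (Ω : Type*) where
  xhat : ℝ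
  q : ℝ
  ξ : ℝ≥0 → Ω → ℝ
  ρ : Ω → ℝ≥0

/-- Shares traded at the exchange up to time `t`: `∫_0^t ξ_s ds`. -/
def Strategy.exchangeTraded {Ω : Type*} (χ : Strategy Ω) (t : ℝ≥0) (ω : Ω) : ℝ :=
  ∫ s in (0 : ℝ)..(t : ℝ), χ.ξ s.toNNReal ω

namespace DarkPoolModel

variable {Ω : Type*} [mΩ : MeasurableSpace Ω] {P : Measure Ω}

/-- The filtration available to a trader who uses the dark-pool order of `χ`. -/
def G (M : DarkPoolModel Ω P) (χ : Strategy Ω) : Filtration ℝ≥0 mΩ :=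
  tradingFiltration M.F M.τ M.y M.τ_measurable M.y_measurable χ.xhat χ.q

/-- The executed part `Y i` of the `(i + 1)`-st incoming order. -/
def Y (M : DarkPoolModel Ω P) (χ : Strategy Ω) (i : ℕ) (ω : Ω) : ℝ :=
  fill χ.xhat χ.q (fun j => M.y j ω) i

/-- The number `N t` of incoming orders up to time `t`. -/
def N (M : DarkPoolModel Ω P) (t : ℝ≥0) (ω : Ω) : ℕ :=
  arrivalCount (fun i => M.τ i ω) t

/-- The amount `Z t` of shares executed in the dark pool until time `t`, without cancellation. -/
def Z (M : DarkPoolModel Ω P) (χ : Strategy Ω) (t : ℝ≥0) (ω : Ω) : ℝ :=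
  darkFilled χ.xhat χ.q (fun i => M.τ i ω) (fun i => M.y i ω) t

/-- `χ` is an admissible strategy for the initial position `X₀` and the horizon `T`. -/
structure IsAdmissible (M : DarkPoolModel Ω P) (X₀ : ℝ) (T : ℝ≥0) (χ : Strategy Ω) : Prop where
  q_nonneg : 0 ≤ χ.q
  q_le : χ.q ≤ |χ.xhat|
  stopping : IsStoppingTime (M.G χ) (fun ω => (χ.ρ ω : WithTop ℝ≥0))
  ρ_lt : ∀ᵐ ω ∂P, χ.ρ ω < T
  predictable : IsStronglyPredictable (M.G χ) χ.ξ
  integrable : ∀ᵐ ω ∂P, IntervalIntegrable (fun s : ℝ => χ.ξ s.toNNReal ω) volume 0 T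
  bounded : ∃ C : ℝ, ∀ᵐ ω ∂P, ∀ t ≤ T, |χ.exchangeTraded t ω| ≤ C
  liquidation : ∀ᵐ ω ∂P, X₀ + χ.exchangeTraded T ω + M.Z χ (χ.ρ ω) ω = 0

/-- The price at the exchange. -/
def exchangePrice (M : DarkPoolModel Ω P) (χ : Strategy Ω) (t : ℝ≥0) (ω : Ω) : ℝ :=
  M.price t ω + M.γ * χ.exchangeTraded t ω + M.h (χ.ξ t ω)

/-- The price at which the `(i + 1)`-st incoming order is executed in the dark pool. -/
def darkPrice (M : DarkPoolModel Ω P) (χ : Strategy Ω) (i : ℕ) (ω : Ω) : ℝ :=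
  M.price (M.τ i ω) ω + M.γ * χ.exchangeTraded (M.τ i ω) ω + M.κ * M.h (χ.ξ (M.τ i ω) ω)

/-- The costs of the strategy `χ`. The integral of `ξ_t` times the exchange price may be `+∞`, since
the temporary-impact costs need not be integrable in time; for an admissible strategy its negative
part is almost surely finite. -/
def cost (M : DarkPoolModel Ω P) (X₀ : ℝ) (T : ℝ≥0) (χ : Strategy Ω) (ω : Ω) : EReal :=
  ((X₀ * M.price 0 ω : ℝ) : EReal)
  + extIntegral (volume.restrict (Set.Ioc (0 : ℝ) T))
      (fun t => ((χ.ξ t.toNNReal ω * M.exchangePrice χ t.toNNReal ω : ℝ) : EReal))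
  + ((M.α * M.γ * ∫ t in (0 : ℝ)..(T : ℝ), M.Z χ (min (χ.ρ ω) t.toNNReal) ω * χ.ξ t.toNNReal ω : ℝ)
      : EReal)
  + ((∑ i ∈ Finset.range (M.N (χ.ρ ω) ω), M.Y χ i ω *
        (M.darkPrice χ i ω
          + M.α * M.γ * Function.leftLim (fun t => M.Z χ t ω) (M.τ i ω)
          + M.β (M.Y χ i ω)) : ℝ) : EReal)

/-- The expected costs of `χ`, in `[-∞, ∞]`. -/
def expectedCost (M : DarkPoolModel Ω P) (X₀ : ℝ) (T : ℝ≥0) (χ : Strategy Ω) : EReal :=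
  extIntegral P (M.cost X₀ T χ)

/-- The expected costs of `χ` exist in `[-∞, ∞]`. -/
def HasExpectedCost (M : DarkPoolModel Ω P) (X₀ : ℝ) (T : ℝ≥0) (χ : Strategy Ω) : Prop :=
  HasExtIntegral P (M.cost X₀ T χ)

/-! ### Regularity notions -/

/-- Up to time `T`, the strategy contains no buy orders: neither at the exchange (almost surely) nor
in the dark pool. -/
def IsSellOnly (P : Measure Ω) (T : ℝ≥0) (χ : Strategy Ω) : Prop :=
  χ.xhat ≤ 0 ∧ ∀ᵐ ω ∂P, ∀ t ≤ T, χ.ξ t ω ≤ 0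

/-- Up to time `T`, the strategy contains no sell orders: neither at the exchange (almost surely)
nor in the dark pool. -/
def IsBuyOnly (P : Measure Ω) (T : ℝ≥0) (χ : Strategy Ω) : Prop :=
  0 ≤ χ.xhat ∧ ∀ᵐ ω ∂P, ∀ t ≤ T, 0 ≤ χ.ξ t ω

/-- The expected costs of `χ` are strictly lower (its expected revenues are strictly higher) than
those of `χ'`. -/
def StrictlyBetter (M : DarkPoolModel Ω P) (X₀ : ℝ) (T : ℝ≥0) (χ χ' : Strategy Ω) : Prop :=
  M.HasExpectedCost X₀ T χ ∧ M.HasExpectedCost X₀ T χ' ∧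
    M.expectedCost X₀ T χ < M.expectedCost X₀ T χ'

/-- There is transaction-triggered price manipulation: for some initial position and horizon, a
strategy for a sell program (`X₀ ≥ 0`) that contains buy orders has strictly higher expected
revenues than all sell-only strategies, or symmetrically for a buy program (`X₀ ≤ 0`). -/
def TransactionTriggeredPriceManipulation (M : DarkPoolModel Ω P) : Prop :=
  ∃ (X₀ : ℝ) (T : ℝ≥0) (χ : Strategy Ω), 0 < T ∧ M.IsAdmissible X₀ T χ ∧ M.HasExpectedCost X₀ T χ ∧
    ((0 ≤ X₀ ∧ (0 < χ.xhat ∨ ¬ ∀ᵐ ω ∂P, ∀ t ≤ T, χ.ξ t ω ≤ 0) ∧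
        ∀ χ', M.IsAdmissible X₀ T χ' → IsSellOnly P T χ' → M.StrictlyBetter X₀ T χ χ') ∨
     (X₀ ≤ 0 ∧ (χ.xhat < 0 ∨ ¬ ∀ᵐ ω ∂P, ∀ t ≤ T, 0 ≤ χ.ξ t ω) ∧
        ∀ χ', M.IsAdmissible X₀ T χ' → IsBuyOnly P T χ' → M.StrictlyBetter X₀ T χ χ'))

/-- The model has nonnegative expected liquidation costs. -/
def NonnegExpectedLiquidationCosts (M : DarkPoolModel Ω P) : Prop :=
  ∀ (X₀ : ℝ) (T : ℝ≥0) (χ : Strategy Ω), 0 < T → M.IsAdmissible X₀ T χ → M.HasExpectedCost X₀ T χ →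
    0 ≤ M.expectedCost X₀ T χ

/-- `χ` is a price manipulation strategy for the horizon `T`: a round trip with strictly negative
expected costs. -/
def IsPriceManipulation (M : DarkPoolModel Ω P) (T : ℝ≥0) (χ : Strategy Ω) : Prop :=
  M.IsAdmissible 0 T χ ∧ M.HasExpectedCost 0 T χ ∧ M.expectedCost 0 T χ < 0

/-- There is price manipulation for some horizon. -/
def PriceManipulation (M : DarkPoolModel Ω P) : Prop :=
  ∃ (T : ℝ≥0) (χ : Strategy Ω), 0 < T ∧ M.IsPriceManipulation T χ

end DarkPoolModel

end

/-! Everything reduces to one claim: an admissible strategy that only sells or only buys has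
well-defined, nonnegative expected costs (`expectedCost_nonneg_of_sign`). Granting it, a strategy
with negative expected costs cannot be sell-only (if `X₀ ≥ 0`) or buy-only (if `X₀ ≤ 0`), yet it
beats every such strategy, which is transaction-triggered manipulation. This is (a); (b) is the case
`X₀ = 0`.

For the claim, every impact term in the costs of a one-sided strategy is a product of two quantities
of the same sign, so the costs dominate those computed with the unaffected price alone
(`unaffectedCost_le_cost`). Because the price is a martingale for the trading filtration, each trade
may be valued at the terminal price `p T` without changing the expectation. The expected unaffected
costs are therefore `E[(X₀ + ∫ξ + Z_ρ) p T]`, which vanishes by the liquidation constraint.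

The work lies in justifying this revaluation, since the running supremum of the price need not be
integrable. For exchange trading (`exchange_martingale_part`) Fubini applies, because one-sidedness
turns the bound on `∫ξ` into one on `∫|ξ|`. For the dark pool (`dark_martingale_part`) the sum over
random times is a pathwise limit of sums over deterministic grids. `martingale_riemann_limit` passes
to expectations by uniform integrability, obtained from conditional Jensen for `x ↦ (|x| - c)⁺`. -/

noncomputable section

/-! ### Conditional expectations against nonnegative weights -/

/-- The excess of `|x|` over the level `c`. -/
def excess (c x : ℝ) : ℝ := max (|x| - c) 0

theorem excess_nonneg (c x : ℝ) : 0 ≤ excess c x := le_max_right _ _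

theorem abs_le_add_excess (c x : ℝ) : |x| ≤ c + excess c x := by
  have := le_max_left (|x| - c) 0
  unfold excess
  linarith

theorem excess_zero (x : ℝ) : excess 0 x = |x| := by
  simp [excess]

theorem continuous_excess (c : ℝ) : Continuous (excess c) :=
  (continuous_abs.sub continuous_const).max continuous_const

section CondExp

variable {Ω : Type*} {m mΩ : MeasurableSpace Ω} {μ : Measure Ω}

theorem integrable_excess [IsFiniteMeasure μ] {X : Ω → ℝ} (hX : Integrable X μ) (c : ℝ) :
    Integrable (fun ω => excess c (X ω)) μ :=
  (hX.abs.sub (integrable_const c)).sup (integrable_const 0)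

theorem tendsto_lintegral_excess {X : Ω → ℝ} (hX : Integrable X μ) :
    Tendsto (fun n : ℕ => ∫⁻ ω, ENNReal.ofReal (excess n (X ω)) ∂μ) atTop (𝓝 0) := by
  have h0 : (0 : ℝ≥0∞) = ∫⁻ _, 0 ∂μ := by simp
  rw [h0]
  refine tendsto_lintegral_of_dominated_convergence' (fun ω => ‖X ω‖ₑ) (fun n => ?_)
    (fun n => ?_) hX.2.ne ?_
  · exact ((continuous_excess n).measurable.comp_aemeasurable hX.1.aemeasurable).ennreal_ofReal
  · refine Eventually.of_forall fun ω => ?_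
    simp only [Real.enorm_eq_ofReal_abs]
    refine ENNReal.ofReal_le_ofReal (max_le ?_ (abs_nonneg _))
    have : (0 : ℝ) ≤ n := n.cast_nonneg
    linarith
  · refine Eventually.of_forall fun ω => ?_
    refine tendsto_const_nhds.congr' ?_
    filter_upwards [eventually_ge_atTop ⌈|X ω|⌉₊] with n hn
    have : |X ω| ≤ n := (Nat.le_ceil _).trans (by exact_mod_cast hn)
    rw [excess, max_eq_right (by linarith), ENNReal.ofReal_zero]

/-- Conditional Jensen by hand: the excess is the maximum of `x - c`, `-x - c` and `0`, and
monotonicity of conditional expectation handles each of the three. -/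
theorem excess_condExp_le [IsFiniteMeasure μ] (hm : m ≤ mΩ) {X : Ω → ℝ} (hX : Integrable X μ)
    (c : ℝ) : ∀ᵐ ω ∂μ, excess c ((μ[X|m]) ω) ≤ (μ[fun ω => excess c (X ω)|m]) ω := by
  have hE := integrable_excess hX c
  have hc : Integrable (fun _ : Ω => c) μ := integrable_const c
  have h1 : μ[X - fun _ => c|m] ≤ᵐ[μ] μ[fun ω => excess c (X ω)|m] := by
    refine condExp_mono (hX.sub hc) hE (Eventually.of_forall fun ω => ?_)
    exact (sub_le_sub_right (le_abs_self _) c).trans (le_max_left _ _)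
  have h2 : μ[-X - fun _ => c|m] ≤ᵐ[μ] μ[fun ω => excess c (X ω)|m] := by
    refine condExp_mono (hX.neg.sub hc) hE (Eventually.of_forall fun ω => ?_)
    exact (sub_le_sub_right (neg_le_abs _) c).trans (le_max_left _ _)
  have h3 : 0 ≤ᵐ[μ] μ[fun ω => excess c (X ω)|m] :=
    condExp_nonneg (Eventually.of_forall fun ω => excess_nonneg c (X ω))
  filter_upwards [h1, h2, h3, condExp_sub hX hc m, condExp_sub hX.neg hc m, condExp_neg X m]
    with ω h1 h2 h3 h4 h5 h6
  rw [h4] at h1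
  rw [h5] at h2
  simp only [Pi.sub_apply, condExp_const hm, h6, Pi.neg_apply] at h1 h2
  refine max_le ?_ h3
  rcases abs_cases ((μ[X|m]) ω) with h | h <;> rw [h.1] <;> assumption

/-- The densities `U` and `V` define measures whose restrictions to `m` are ordered, since `∫_A U ≤
∫_A μ[V|m] = ∫_A V` for `A` in `m`. Integrating `W` against both avoids any integrability assumption
on `W`. -/
theorem lintegral_mul_ofReal_le_of_le_condExp [IsFiniteMeasure μ] (hm : m ≤ mΩ) {U V : Ω → ℝ}
    {W : Ω → ℝ≥0∞} (hW : Measurable[m] W) (hU : AEMeasurable U μ) (hV : Integrable V μ)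
    (hV0 : ∀ ω, 0 ≤ V ω) (hUV : U ≤ᵐ[μ] μ[V|m]) :
    ∫⁻ ω, W ω * ENNReal.ofReal (U ω) ∂μ ≤ ∫⁻ ω, W ω * ENNReal.ofReal (V ω) ∂μ := by
  have key : (μ.withDensity fun ω => ENNReal.ofReal (U ω)).trim hm
      ≤ (μ.withDensity fun ω => ENNReal.ofReal (V ω)).trim hm := by
    refine Measure.le_iff.2 fun A hA => ?_
    rw [trim_measurableSet_eq hm hA, trim_measurableSet_eq hm hA, withDensity_apply _ (hm A hA),
      withDensity_apply _ (hm A hA)]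
    calc ∫⁻ ω in A, ENNReal.ofReal (U ω) ∂μ
        ≤ ∫⁻ ω in A, ENNReal.ofReal ((μ[V|m]) ω) ∂μ :=
          lintegral_mono_ae ((ae_restrict_of_ae hUV).mono fun ω h => ENNReal.ofReal_le_ofReal h)
      _ = ENNReal.ofReal (∫ ω in A, (μ[V|m]) ω ∂μ) :=
          (ofReal_integral_eq_lintegral_ofReal integrable_condExp.integrableOn
            (ae_restrict_of_ae (condExp_nonneg (Eventually.of_forall hV0)))).symm
      _ = ENNReal.ofReal (∫ ω in A, V ω ∂μ) := by rw [setIntegral_condExp hm hV hA]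
      _ = ∫⁻ ω in A, ENNReal.ofReal (V ω) ∂μ :=
          ofReal_integral_eq_lintegral_ofReal hV.integrableOn (Eventually.of_forall hV0)
  have h : ∀ F : Ω → ℝ, AEMeasurable F μ → ∫⁻ ω, W ω * ENNReal.ofReal (F ω) ∂μ
      = ∫⁻ ω, W ω ∂((μ.withDensity fun ω => ENNReal.ofReal (F ω)).trim hm) := fun F hF => by
    rw [lintegral_trim hm hW, lintegral_withDensity_eq_lintegral_mul₀ hF.ennreal_ofReal
      (hW.mono hm le_rfl).aemeasurable]
    simp [mul_comm]
  rw [h U hU, h V hV.1.aemeasurable]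
  exact lintegral_mono' key le_rfl

theorem lintegral_mul_excess_le [IsFiniteMeasure μ] (hm : m ≤ mΩ) {X Q : Ω → ℝ}
    {W : Ω → ℝ≥0∞} (hW : Measurable[m] W) (hX : Integrable X μ) (hQ : μ[X|m] =ᵐ[μ] Q) (c : ℝ) :
    ∫⁻ ω, W ω * ENNReal.ofReal (excess c (Q ω)) ∂μ
      ≤ ∫⁻ ω, W ω * ENNReal.ofReal (excess c (X ω)) ∂μ := by
  have hQi : Integrable Q μ := integrable_condExp.congr hQ
  refine lintegral_mul_ofReal_le_of_le_condExp hm hW (integrable_excess hQi c).1.aemeasurable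
    (integrable_excess hX c) (fun ω => excess_nonneg c _) ?_
  filter_upwards [excess_condExp_le hm hX c, hQ] with ω h1 h2
  rwa [← h2]

theorem integrable_mul_of_condExp [IsFiniteMeasure μ] {X Q W : Ω → ℝ}
    (hW : StronglyMeasurable[m] W) (hX : Integrable X μ) (hWX : Integrable (W * X) μ)
    (hQ : μ[X|m] =ᵐ[μ] Q) : Integrable (W * Q) μ := by
  refine (integrable_condExp (f := W * X) (m := m)).congr ?_
  filter_upwards [condExp_mul_of_stronglyMeasurable_left hW hWX hX, hQ] with ω h1 h2
  rw [h1, Pi.mul_apply, Pi.mul_apply, h2]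

theorem integral_mul_of_condExp [IsFiniteMeasure μ] (hm : m ≤ mΩ) {X Q W : Ω → ℝ}
    (hW : StronglyMeasurable[m] W) (hX : Integrable X μ) (hWX : Integrable (W * X) μ)
    (hQ : μ[X|m] =ᵐ[μ] Q) : ∫ ω, W ω * Q ω ∂μ = ∫ ω, W ω * X ω ∂μ := by
  calc ∫ ω, W ω * Q ω ∂μ = ∫ ω, (μ[W * X|m]) ω ∂μ := by
        refine integral_congr_ae ?_
        filter_upwards [condExp_mul_of_stronglyMeasurable_left hW hWX hX, hQ] with ω h1 h2
        rw [h1, Pi.mul_apply, h2]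
    _ = ∫ ω, (W * X) ω ∂μ := integral_condExp hm

end CondExp

/-! ### Absolutely continuous trading against a martingale -/

theorem tendsto_nat_floor_succ_div (t : ℝ≥0) :
    Tendsto (fun n : ℕ => ((⌊t * (n + 1)⌋₊ + 1 : ℕ) : ℝ≥0) / (n + 1)) atTop (𝓝[≥] t) := by
  have hle : ∀ n : ℕ, t ≤ ((⌊t * (n + 1)⌋₊ + 1 : ℕ) : ℝ≥0) / (n + 1) := fun n => by
    rw [le_div_iff₀ (by positivity)]
    exact_mod_cast (Nat.lt_floor_add_one (t * (n + 1))).le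
  have hup : ∀ n : ℕ, ((⌊t * (n + 1)⌋₊ + 1 : ℕ) : ℝ≥0) / (n + 1) ≤ t + 1 / (n + 1) := fun n => by
    rw [div_le_iff₀ (by positivity), add_mul, one_div, inv_mul_cancel₀ (by positivity)]
    push_cast
    gcongr
    exact Nat.floor_le (by positivity)
  refine tendsto_nhdsWithin_iff.2 ⟨?_, Eventually.of_forall hle⟩
  refine tendsto_of_tendsto_of_tendsto_of_le_of_le tendsto_const_nhds ?_ hle hup
  simpa using tendsto_const_nhds.add (tendsto_one_div_add_atTop_nhds_zero_nat (𝕜 := ℝ≥0))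

theorem measurable_uncurry_of_rightCont {Ω : Type*} [MeasurableSpace Ω] {p : ℝ≥0 → Ω → ℝ}
    (hp : ∀ t, Measurable (p t))
    (hr : ∀ ω t, ContinuousWithinAt (fun s => p s ω) (Set.Ici t) t) :
    Measurable (Function.uncurry p) := by
  refine measurable_of_tendsto_metrizable
    -- The `+ 1` puts the approximating time to the right of `t`, where right-continuity gives
    -- convergence.
    (f := fun (n : ℕ) (x : ℝ≥0 × Ω) =>
      p (((⌊x.1 * (n + 1)⌋₊ + 1 : ℕ) : ℝ≥0) / (n + 1)) x.2) (fun n => ?_) ?_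
  · have h1 : Measurable (fun x : ℕ × Ω => p (((x.1 + 1 : ℕ) : ℝ≥0) / (n + 1)) x.2) :=
      measurable_from_prod_countable_right fun k => hp (((k + 1 : ℕ) : ℝ≥0) / (n + 1))
    have h2 : Measurable (fun x : ℝ≥0 × Ω => (⌊x.1 * (n + 1)⌋₊, x.2)) :=
      (Nat.measurable_floor.comp (measurable_fst.mul_const _)).prodMk measurable_snd
    exact h1.comp h2
  · refine tendsto_pi_nhds.2 fun x => ?_
    exact (hr x.2 x.1).tendsto.comp (tendsto_nat_floor_succ_div x.1)

/-- Fubini reduces the identity to `E[ξ_t p_t] = E[ξ_t p_T]` at a fixed time, which is the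
martingale property. -/
theorem exchange_martingale_part {Ω : Type*} [mΩ : MeasurableSpace Ω] {P : Measure Ω}
    [IsFiniteMeasure P] {G : Filtration ℝ≥0 mΩ} {p ξ : ℝ≥0 → Ω → ℝ} (hp : Martingale p G P)
    (hr : ∀ ω t, ContinuousWithinAt (fun s => p s ω) (Set.Ici t) t)
    (hξ : StronglyAdapted G ξ) (hξm : Measurable (Function.uncurry ξ)) (T : ℝ≥0) (C : ℝ)
    (hC : ∀ᵐ ω ∂P, ∫⁻ t in Set.Ioc (0 : ℝ) T, ‖ξ t.toNNReal ω‖ₑ ≤ ENNReal.ofReal C) :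
    (∀ᵐ ω ∂P, IntegrableOn (fun t : ℝ => ξ t.toNNReal ω * p t.toNNReal ω) (Set.Ioc 0 T)) ∧
    Integrable (fun ω => ∫ t in Set.Ioc (0 : ℝ) T, ξ t.toNNReal ω * p t.toNNReal ω) P ∧
    Integrable (fun ω => (∫ t in Set.Ioc (0 : ℝ) T, ξ t.toNNReal ω) * p T ω) P ∧
    ∫ ω, (∫ t in Set.Ioc (0 : ℝ) T, ξ t.toNNReal ω * p t.toNNReal ω) ∂P
      = ∫ ω, (∫ t in Set.Ioc (0 : ℝ) T, ξ t.toNNReal ω) * p T ω ∂P := by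
  set ν := (volume : Measure ℝ).restrict (Set.Ioc (0 : ℝ) T) with hν
  have hpm : Measurable (Function.uncurry p) :=
    measurable_uncurry_of_rightCont (fun t => ((hp.1 t).mono (G.le t)).measurable) hr
  have hφ : Measurable fun x : ℝ × Ω => (x.1.toNNReal, x.2) :=
    (measurable_real_toNNReal.comp measurable_fst).prodMk measurable_snd
  have hξ' : Measurable fun x : ℝ × Ω => ξ x.1.toNNReal x.2 := hξm.comp hφ
  have hp' : Measurable fun x : ℝ × Ω => p x.1.toNNReal x.2 := hpm.comp hφ
  have hpT : Measurable fun x : ℝ × Ω => p T x.2 :=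
    ((hp.1 T).mono (G.le T)).measurable.comp measurable_snd
  have hfm : Measurable fun x : ℝ × Ω => ξ x.1.toNNReal x.2 * p T x.2 := hξ'.mul hpT
  have hgm : Measurable fun x : ℝ × Ω => ξ x.1.toNNReal x.2 * p x.1.toNNReal x.2 := hξ'.mul hp'
  have hpTi : Integrable (p T) P := hp.integrable T
  -- With the price frozen at `T` it leaves the time integral, and the bound on `∫|ξ|` suffices.
  have hf : Integrable (fun x : ℝ × Ω => ξ x.1.toNNReal x.2 * p T x.2) (ν.prod P) := by
    refine ⟨hfm.aestronglyMeasurable, ?_⟩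
    rw [HasFiniteIntegral, lintegral_prod_symm' _ hfm.enorm]
    calc ∫⁻ ω, ∫⁻ t, ‖ξ t.toNNReal ω * p T ω‖ₑ ∂ν ∂P
        ≤ ∫⁻ ω, ENNReal.ofReal C * ‖p T ω‖ₑ ∂P := by
          refine lintegral_mono_ae (hC.mono fun ω h => ?_)
          simp_rw [enorm_mul]
          rw [lintegral_mul_const' _ _ enorm_ne_top]
          gcongr
      _ = ENNReal.ofReal C * ∫⁻ ω, ‖p T ω‖ₑ ∂P := lintegral_const_mul' _ _ ENNReal.ofReal_ne_top
      _ < ∞ := ENNReal.mul_lt_top ENNReal.ofReal_lt_top hpTi.2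
  have hg : Integrable (fun x : ℝ × Ω => ξ x.1.toNNReal x.2 * p x.1.toNNReal x.2)
      (ν.prod P) := by
    refine ⟨hgm.aestronglyMeasurable, ?_⟩
    have h2 := hf.2
    rw [HasFiniteIntegral, lintegral_prod _ hfm.enorm.aemeasurable] at h2
    rw [HasFiniteIntegral, lintegral_prod _ hgm.enorm.aemeasurable]
    refine lt_of_le_of_lt (lintegral_mono_ae ?_) h2
    filter_upwards [ae_restrict_mem measurableSet_Ioc] with t ht
    have htT : t.toNNReal ≤ T := Real.toNNReal_le_iff_le_coe.2 ht.2
    -- At level `0` the excess is `|·|`, so this reads `E|ξ_t p_t| ≤ E|ξ_t p_T|`.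
    have h3 := lintegral_mul_excess_le (G.le t.toNNReal) (hξ t.toNNReal).enorm hpTi
      (hp.2 _ _ htT) 0
    simpa only [excess_zero, ← Real.enorm_eq_ofReal_abs, ← enorm_mul] using h3
  have hfs : Integrable (fun ω => (∫ t, ξ t.toNNReal ω ∂ν) * p T ω) P := by
    simpa only [integral_mul_const] using hf.integral_prod_right
  refine ⟨hg.prod_left_ae, hg.integral_prod_right, hfs, ?_⟩
  calc ∫ ω, ∫ t, ξ t.toNNReal ω * p t.toNNReal ω ∂ν ∂P
      = ∫ t, ∫ ω, ξ t.toNNReal ω * p t.toNNReal ω ∂P ∂ν := (integral_integral_swap hg).symm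
    _ = ∫ t, ∫ ω, ξ t.toNNReal ω * p T ω ∂P ∂ν := by
        refine integral_congr_ae ?_
        filter_upwards [ae_restrict_mem measurableSet_Ioc, hf.prod_right_ae] with t ht hi
        exact integral_mul_of_condExp (G.le t.toNNReal) (hξ t.toNNReal) hpTi hi
          (hp.2 _ _ (Real.toNNReal_le_iff_le_coe.2 ht.2))
    _ = ∫ ω, ∫ t, ξ t.toNNReal ω * p T ω ∂ν ∂P := integral_integral_swap hf
    _ = ∫ ω, (∫ t, ξ t.toNNReal ω ∂ν) * p T ω ∂P := by simp only [integral_mul_const]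

/-! ### Limits of martingale Riemann sums -/

/-- Each finite sum has the expectation of its weights times `p T`. On that side dominated
convergence applies with the bound `B * |p T|`; on the other side, Vitali's theorem. -/
theorem martingale_riemann_limit {Ω : Type*} [mΩ : MeasurableSpace Ω] {P : Measure Ω}
    [IsFiniteMeasure P] {G : Filtration ℝ≥0 mΩ} {p : ℝ≥0 → Ω → ℝ} (hp : Martingale p G P)
    {T : ℝ≥0} {s : ℕ → ℕ → ℝ≥0} (hs : ∀ n, ∀ k ∈ Finset.range (n + 1), s n k ≤ T)
    {W : ℕ → ℕ → Ω → ℝ} (hW : ∀ n k, StronglyMeasurable[G (s n k)] (W n k)) {B : ℝ} (hB : 0 ≤ B)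
    (hWB : ∀ n, ∀ᵐ ω ∂P, ∑ k ∈ Finset.range (n + 1), |W n k ω| ≤ B) {J V : Ω → ℝ}
    (hJ : ∀ᵐ ω ∂P, Tendsto (fun n => ∑ k ∈ Finset.range (n + 1), W n k ω * p (s n k) ω)
      atTop (𝓝 (J ω)))
    (hV : ∀ᵐ ω ∂P, Tendsto (fun n => ∑ k ∈ Finset.range (n + 1), W n k ω) atTop (𝓝 (V ω))) :
    Integrable J P ∧ Integrable (fun ω => V ω * p T ω) P ∧
      ∫ ω, J ω ∂P = ∫ ω, V ω * p T ω ∂P := by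
  have hpT := hp.integrable T
  have hWm : ∀ n k, StronglyMeasurable (W n k) := fun n k => (hW n k).mono (G.le _)
  have hWb : ∀ n, ∀ k ∈ Finset.range (n + 1), ∀ᵐ ω ∂P, ‖W n k ω‖ ≤ B := fun n k hk =>
    (hWB n).mono fun ω h =>
      (Finset.single_le_sum (f := fun k => |W n k ω|) (fun _ _ => abs_nonneg _) hk).trans h
  have hWp : ∀ n, ∀ k ∈ Finset.range (n + 1), Integrable (fun ω => W n k ω * p T ω) P := fun n k hk =>
    hpT.bdd_mul (hWm n k).aestronglyMeasurable (hWb n k hk)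
  have hWs : ∀ n, ∀ k ∈ Finset.range (n + 1), Integrable (fun ω => W n k ω * p (s n k) ω) P :=
    fun n k hk =>
    integrable_mul_of_condExp (hW n k) hpT (hWp n k hk) (hp.2 _ _ (hs n k hk))
  set S : ℕ → Ω → ℝ := fun n ω => ∑ k ∈ Finset.range (n + 1), W n k ω * p (s n k) ω with hS
  have hSi : ∀ n, Integrable (S n) P := fun n => integrable_finsetSum _ fun k hk => hWs n k hk
  have hSint : ∀ n, ∫ ω, S n ω ∂P
      = ∫ ω, (∑ k ∈ Finset.range (n + 1), W n k ω) * p T ω ∂P := fun n => by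
    simp_rw [hS, Finset.sum_mul]
    rw [integral_finsetSum _ fun k hk => hWs n k hk, integral_finsetSum _ fun k hk => hWp n k hk]
    exact Finset.sum_congr rfl fun k hk =>
      integral_mul_of_condExp (G.le _) (hW n k) hpT (hWp n k hk) (hp.2 _ _ (hs n k hk))
  -- the limit of the integrals, by dominated convergence
  have hVm : ∀ n, AEStronglyMeasurable (fun ω => (∑ k ∈ Finset.range (n + 1), W n k ω) * p T ω) P :=
    fun n => (Finset.stronglyMeasurable_fun_sum _ fun k _ => hWm n k).aestronglyMeasurable.mul hpT.1
  have hVb : ∀ n, ∀ᵐ ω ∂P, ‖(∑ k ∈ Finset.range (n + 1), W n k ω) * p T ω‖ ≤ B * ‖p T ω‖ :=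
    fun n => (hWB n).mono fun ω h => by
      rw [norm_mul]
      gcongr
      exact (Finset.abs_sum_le_sum_abs _ _).trans h
  have hVt : ∀ᵐ ω ∂P, Tendsto (fun n => (∑ k ∈ Finset.range (n + 1), W n k ω) * p T ω) atTop
      (𝓝 (V ω * p T ω)) := hV.mono fun ω h => h.mul_const _
  have hlim := tendsto_integral_of_dominated_convergence _ hVm (hpT.norm.const_mul B) hVb hVt
  have hVi : Integrable (fun ω => V ω * p T ω) P := by
    refine (hpT.norm.const_mul B).mono' (aestronglyMeasurable_of_tendsto_ae _ hVm hVt) ?_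
    filter_upwards [hVt, ae_all_iff.2 hVb] with ω h1 h2
    exact le_of_tendsto h1.norm (Eventually.of_forall h2)
  -- uniform bounds on the excess
  set R : ℝ → ℕ → Ω → ℝ≥0∞ := fun c n ω =>
    ∑ k ∈ Finset.range (n + 1), ‖W n k ω‖ₑ * ENNReal.ofReal (excess c (p (s n k) ω)) with hR
  have hWe : ∀ n, ∀ᵐ ω ∂P, ∑ k ∈ Finset.range (n + 1), ‖W n k ω‖ₑ ≤ ENNReal.ofReal B :=
    fun n => (hWB n).mono fun ω h => by
      simp_rw [Real.enorm_eq_ofReal_abs]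
      rw [← ENNReal.ofReal_sum_of_nonneg fun _ _ => abs_nonneg _]
      exact ENNReal.ofReal_le_ofReal h
  have hexm : ∀ c t, AEMeasurable (fun ω => ENNReal.ofReal (excess c (p t ω))) P := fun c t =>
    ((continuous_excess c).measurable.comp_aemeasurable
      (hp.integrable t).1.aemeasurable).ennreal_ofReal
  have hRle : ∀ c n, ∫⁻ ω, R c n ω ∂P
      ≤ ENNReal.ofReal B * ∫⁻ ω, ENNReal.ofReal (excess c (p T ω)) ∂P := fun c n => by
    calc ∫⁻ ω, R c n ω ∂P
        = ∑ k ∈ Finset.range (n + 1),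
            ∫⁻ ω, ‖W n k ω‖ₑ * ENNReal.ofReal (excess c (p (s n k) ω)) ∂P :=
          lintegral_finsetSum' _ fun k _ => (hWm n k).enorm.aemeasurable.mul (hexm c _)
      _ ≤ ∑ k ∈ Finset.range (n + 1), ∫⁻ ω, ‖W n k ω‖ₑ * ENNReal.ofReal (excess c (p T ω)) ∂P :=
          Finset.sum_le_sum fun k hk =>
            lintegral_mul_excess_le (G.le _) (hW n k).enorm hpT (hp.2 _ _ (hs n k hk)) c
      _ = ∫⁻ ω, (∑ k ∈ Finset.range (n + 1), ‖W n k ω‖ₑ) * ENNReal.ofReal (excess c (p T ω)) ∂P := by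
          simp_rw [Finset.sum_mul]
          exact (lintegral_finsetSum' _ fun k _ =>
            (hWm n k).enorm.aemeasurable.mul (hexm c T)).symm
      _ ≤ ∫⁻ ω, ENNReal.ofReal B * ENNReal.ofReal (excess c (p T ω)) ∂P :=
          lintegral_mono_ae ((hWe n).mono fun ω h => mul_le_mul_left h _)
      _ = _ := lintegral_const_mul' _ _ ENNReal.ofReal_ne_top
  -- Splitting `|p| ≤ c + excess c p` separates a bounded part from a tail whose expectation is
  -- small uniformly in `n`.
  have hSle : ∀ c, 0 ≤ c → ∀ n, ∀ᵐ ω ∂P,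
      ‖S n ω‖ₑ ≤ ENNReal.ofReal (B * c) + R c n ω := fun c hc n => (hWe n).mono fun ω h => by
    calc ‖S n ω‖ₑ ≤ ∑ k ∈ Finset.range (n + 1), ‖W n k ω * p (s n k) ω‖ₑ := enorm_sum_le _ _
      _ ≤ ∑ k ∈ Finset.range (n + 1), (‖W n k ω‖ₑ * ENNReal.ofReal c
            + ‖W n k ω‖ₑ * ENNReal.ofReal (excess c (p (s n k) ω))) := by
          refine Finset.sum_le_sum fun k _ => ?_
          rw [enorm_mul, ← mul_add, ← ENNReal.ofReal_add hc (excess_nonneg _ _)]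
          gcongr
          rw [Real.enorm_eq_ofReal_abs]
          exact ENNReal.ofReal_le_ofReal (abs_le_add_excess _ _)
      _ ≤ _ := by
          rw [Finset.sum_add_distrib, ← Finset.sum_mul, ENNReal.ofReal_mul hB]
          gcongr
  -- uniform integrability
  have hUI : UnifIntegrable S 1 P := fun ε hε => by
    have h1 : Tendsto (fun n : ℕ => ENNReal.ofReal B * ∫⁻ ω, ENNReal.ofReal (excess n (p T ω)) ∂P)
        atTop (𝓝 0) := by
      simpa using ENNReal.Tendsto.const_mul (tendsto_lintegral_excess hpT)
        (Or.inr ENNReal.ofReal_ne_top)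
    obtain ⟨N, hN⟩ := (h1.eventually_le_const (ENNReal.ofReal_pos.2 (half_pos hε))).exists
    have hN0 : (0 : ℝ) ≤ N := N.cast_nonneg
    have hpos : 0 < B * N + 1 := by positivity
    -- The tail above level `N` costs at most `ε / 2`; on a set this small, so does the part bounded
    -- by `B * N`. The `+ 1` guards against `B * N = 0`.
    refine ⟨ε / 2 / (B * N + 1), by positivity, fun n A hA hPA => ?_⟩
    rw [eLpNorm_indicator_eq_eLpNorm_restrict hA, eLpNorm_one_eq_lintegral_enorm]
    calc ∫⁻ ω in A, ‖S n ω‖ₑ ∂P ≤ ∫⁻ ω in A, (ENNReal.ofReal (B * N) + R N n ω) ∂P :=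
          lintegral_mono_ae (ae_restrict_of_ae (hSle N hN0 n))
      _ = ENNReal.ofReal (B * N) * P A + ∫⁻ ω in A, R N n ω ∂P := by
          rw [lintegral_add_left measurable_const, setLIntegral_const]
      _ ≤ ENNReal.ofReal (B * N) * ENNReal.ofReal (ε / 2 / (B * N + 1))
          + ENNReal.ofReal (ε / 2) := by
          gcongr
          exact (setLIntegral_le_lintegral _ _).trans ((hRle N n).trans hN)
      _ ≤ ENNReal.ofReal ε := by
          rw [← ENNReal.ofReal_mul (by positivity), ← ENNReal.ofReal_add (by positivity)
            (by positivity)]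
          refine ENNReal.ofReal_le_ofReal ?_
          have : B * N * (ε / 2 / (B * N + 1)) ≤ ε / 2 := by
            rw [mul_div_assoc', div_le_iff₀ hpos]
            nlinarith
          linarith
  have hJi : Integrable J P := by
    refine ⟨aestronglyMeasurable_of_tendsto_ae _ (fun n => (hSi n).1) hJ, ?_⟩
    -- Fatou, combined with the uniform `L¹` bound given by level `0`.
    have h1 : ∫⁻ ω, ‖J ω‖ₑ ∂P ≤ liminf (fun n => ∫⁻ ω, ‖S n ω‖ₑ ∂P) atTop := by
      refine le_trans (lintegral_mono_ae (hJ.mono fun ω h => ?_))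
        (lintegral_liminf_le' fun n => (hSi n).1.enorm)
      exact (h.enorm.liminf_eq).ge
    refine lt_of_le_of_lt (h1.trans (liminf_le_of_frequently_le'
      (x := ENNReal.ofReal B * ∫⁻ ω, ‖p T ω‖ₑ ∂P) (Frequently.of_forall fun n => ?_)))
      (ENNReal.mul_lt_top ENNReal.ofReal_lt_top hpT.2)
    refine (lintegral_mono_ae (hSle 0 le_rfl n)).trans ?_
    simpa only [mul_zero, ENNReal.ofReal_zero, zero_add, excess_zero,
      ← Real.enorm_eq_ofReal_abs] using hRle 0 n
  refine ⟨hJi, hVi, ?_⟩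
  have hL1 := tendsto_Lp_finite_of_tendsto_ae le_rfl ENNReal.one_ne_top (fun n => (hSi n).1)
    (memLp_one_iff_integrable.2 hJi) hUI hJ
  have h2 := tendsto_integral_of_L1' J hJi.1 (Eventually.of_forall hSi) hL1
  simp_rw [hSint] at h2
  exact tendsto_nhds_unique h2 hlim

/-! ### Executed orders along a path -/

section Path

variable {xhat : ℝ} {τ : ℕ → ℝ≥0}

theorem fillStep_nonneg (xhat q : ℝ) (y : ℝ≥0∞) (s : ℝ) : 0 ≤ fillStep xhat q y s := by
  unfold fillStep
  split_ifs
  exacts [ENNReal.toReal_nonneg, le_rfl]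

theorem fillStep_le {xhat s : ℝ} (hs : s ≤ |xhat|) (q : ℝ) (y : ℝ≥0∞) :
    fillStep xhat q y s ≤ |xhat| - s := by
  unfold fillStep
  split_ifs
  -- The minimum is finite even when the incoming order has size `∞`.
  · exact (ENNReal.toReal_mono ENNReal.ofReal_ne_top (min_le_right _ _)).trans_eq
      (ENNReal.toReal_ofReal (sub_nonneg.2 hs))
  · exact sub_nonneg.2 hs

theorem cumFill_le (xhat q : ℝ) (y : ℕ → ℝ≥0∞) (n : ℕ) : cumFill xhat q y n ≤ |xhat| := by
  induction n with
  | zero => exact abs_nonneg _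
  | succ n ih =>
    have := fillStep_le ih q (y n)
    rw [cumFill]
    linarith

theorem cumFill_eq_sum (xhat q : ℝ) (y : ℕ → ℝ≥0∞) (n : ℕ) :
    cumFill xhat q y n = ∑ i ∈ Finset.range n, fillStep xhat q (y i) (cumFill xhat q y i) := by
  induction n with
  | zero => simp [cumFill]
  | succ n ih => rw [Finset.sum_range_succ, ← ih, cumFill]

theorem abs_fill_le (xhat q : ℝ) (y : ℕ → ℝ≥0∞) (i : ℕ) :
    |fill xhat q y i| ≤ fillStep xhat q (y i) (cumFill xhat q y i) := by
  rw [fill, abs_mul, abs_of_nonneg (fillStep_nonneg _ _ _ _)]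
  refine mul_le_of_le_one_left (fillStep_nonneg _ _ _ _) ?_
  rcases Real.sign_apply_eq xhat with h | h | h <;> simp [h]

theorem sum_abs_fill_le (xhat q : ℝ) (y : ℕ → ℝ≥0∞) (n : ℕ) :
    ∑ i ∈ Finset.range n, |fill xhat q y i| ≤ |xhat| :=
  (Finset.sum_le_sum fun i _ => abs_fill_le xhat q y i).trans
    ((cumFill_eq_sum xhat q y n).symm.trans_le (cumFill_le xhat q y n))

theorem mul_fill_nonneg {ε : ℝ} (h : 0 ≤ ε * xhat) (q : ℝ) (y : ℕ → ℝ≥0∞) (i : ℕ) :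
    0 ≤ ε * fill xhat q y i := by
  rw [fill, ← mul_assoc]
  refine mul_nonneg ?_ (fillStep_nonneg _ _ _ _)
  rcases lt_trichotomy xhat 0 with hx | hx | hx
  · rw [Real.sign_of_neg hx]
    nlinarith
  · simp [hx]
  · rw [Real.sign_of_pos hx]
    nlinarith

theorem mul_darkFilled_nonneg {ε : ℝ} (h : 0 ≤ ε * xhat) (q : ℝ) (τ : ℕ → ℝ≥0)
    (y : ℕ → ℝ≥0∞) (t : ℝ≥0) : 0 ≤ ε * darkFilled xhat q τ y t := by
  rw [darkFilled, Finset.mul_sum]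
  exact Finset.sum_nonneg fun i _ => mul_fill_nonneg h q y i

/-- Monotonicity makes the arrivals up to `t` an initial segment, and divergence makes it finite, so
that `Set.ncard` does not take its default value `0`. -/
theorem lt_arrivalCount_iff (hτ : StrictMono τ) (ht : Tendsto τ atTop atTop) (t : ℝ≥0) (i : ℕ) :
    i < arrivalCount τ t ↔ τ i ≤ t := by
  classical
  have hex : ∃ n, t < τ n := (ht.eventually_gt_atTop t).exists
  have h : {i | τ i ≤ t} = Set.Iio (Nat.find hex) := by
    ext j
    simp only [Set.mem_ofPred_eq, Set.mem_Iio, Nat.lt_find_iff, not_lt]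
    exact ⟨fun hj m hm => (hτ.monotone hm).trans hj, fun hj => hj j le_rfl⟩
  have h2 : arrivalCount τ t = Nat.find hex := by
    rw [arrivalCount, h, ← Finset.coe_Iio, Set.ncard_coe_finset, Nat.card_Iio]
  rw [h2, ← Set.mem_Iio, ← h, Set.mem_ofPred_eq]

theorem sum_arrivalCount_eq (hτ : StrictMono τ) (ht : Tendsto τ atTop atTop) {s t : ℝ≥0}
    (hst : s ≤ t) (f : ℕ → ℝ) : ∑ i ∈ Finset.range (arrivalCount τ s), f i
      = ∑ i ∈ Finset.range (arrivalCount τ t), if τ i ≤ s then f i else 0 := by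
  rw [← Finset.sum_filter]
  refine Finset.sum_congr ?_ fun _ _ => rfl
  ext i
  simp only [Finset.mem_range, Finset.mem_filter, lt_arrivalCount_iff hτ ht]
  exact ⟨fun h => ⟨h.trans hst, h⟩, fun h => h.2⟩

end Path

theorem mul_leftLim_nonneg {ε : ℝ} {f : ℝ≥0 → ℝ} (hf : ∀ t, 0 ≤ ε * f t) (t : ℝ≥0) :
    0 ≤ ε * Function.leftLim f t := by
  -- `Function.leftLim` defaults to `f t` at the left end of the line and where no limit exists.
  rcases (𝓝[<] t).eq_or_neBot with h | h
  · rw [leftLim_eq_of_eq_bot _ h]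
    exact hf t
  by_cases hl : ∃ l, Tendsto f (𝓝[<] t) (𝓝 l)
  · obtain ⟨l, hl⟩ := hl
    rw [leftLim_eq_of_tendsto hl]
    exact ge_of_tendsto' (hl.const_mul ε) hf
  · rw [leftLim_eq_of_not_tendsto _ hl]
    exact hf t

/-! ### Equidistant grids -/

/-- The `k`-th point of the grid that divides `[0, T]` into `n + 1` intervals. -/
def gridPoint (T : ℝ≥0) (n k : ℕ) : ℝ≥0 := T * k / (n + 1)

/-- The index of the cell `(gridPoint T n k, gridPoint T n (k + 1)]` that contains `s`. -/
def gridCell (T : ℝ≥0) (n : ℕ) (s : ℝ≥0) : ℕ := ⌈s * (n + 1) / T⌉₊ - 1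

section Grid

variable {T s : ℝ≥0} (n : ℕ)

theorem gridPoint_mono (T : ℝ≥0) : Monotone (gridPoint T n) := fun a b h => by
  unfold gridPoint
  gcongr

theorem gridPoint_last (T : ℝ≥0) : gridPoint T n (n + 1) = T := by
  unfold gridPoint
  push_cast
  exact mul_div_cancel_right₀ _ (by positivity)

theorem gridPoint_le (T : ℝ≥0) {k : ℕ} (hk : k ∈ Finset.range (n + 1)) :
    gridPoint T n (k + 1) ≤ T :=
  (gridPoint_mono n T (Finset.mem_range.1 hk)).trans_eq (gridPoint_last n T)

theorem gridPoint_succ (T : ℝ≥0) (k : ℕ) :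
    gridPoint T n (k + 1) = gridPoint T n k + T * (1 / (n + 1)) := by
  unfold gridPoint
  push_cast
  ring

theorem gridCell_add_one (hs : 0 < s) (hT : 0 < T) :
    gridCell T n s + 1 = ⌈s * (n + 1) / T⌉₊ := by
  -- Positivity of `s` makes the truncated subtraction in `gridCell` exact.
  have : 0 < ⌈s * (n + 1) / T⌉₊ := Nat.ceil_pos.2 (by positivity)
  unfold gridCell
  omega

theorem gridPoint_gridCell_lt (hs : 0 < s) (hT : 0 < T) :
    gridPoint T n (gridCell T n s) < s := by
  have h : gridCell T n s < ⌈s * (n + 1) / T⌉₊ := by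
    rw [← gridCell_add_one n hs hT]
    exact Nat.lt_succ_self _
  have h2 := Nat.lt_ceil.1 h
  rw [lt_div_iff₀ hT] at h2
  rw [gridPoint, div_lt_iff₀ (by positivity), mul_comm]
  exact h2

theorem le_gridPoint_gridCell_add_one (hs : 0 < s) (hT : 0 < T) :
    s ≤ gridPoint T n (gridCell T n s + 1) := by
  have h2 := Nat.le_ceil (s * (n + 1) / T)
  rw [← gridCell_add_one n hs hT, div_le_iff₀ hT] at h2
  rw [gridPoint, le_div_iff₀ (by positivity), mul_comm T]
  exact h2

theorem eq_gridCell (hs : 0 < s) (hT : 0 < T) {k : ℕ} (h1 : gridPoint T n k < s)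
    (h2 : s ≤ gridPoint T n (k + 1)) : k = gridCell T n s := by
  have h3 := (gridPoint_mono n T).reflect_lt (h1.trans_le (le_gridPoint_gridCell_add_one n hs hT))
  have h4 := (gridPoint_mono n T).reflect_lt ((gridPoint_gridCell_lt n hs hT).trans_le h2)
  omega

theorem gridCell_mem_range (hs : 0 < s) (hT : 0 < T) (hsT : s ≤ T) :
    gridCell T n s ∈ Finset.range (n + 1) := by
  refine Finset.mem_range.2 ((gridPoint_mono n T).reflect_lt ?_)
  rw [gridPoint_last]
  exact (gridPoint_gridCell_lt n hs hT).trans_le hsT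

theorem sum_gridCell (hs : 0 < s) (hT : 0 < T) (hsT : s ≤ T) (u : ℕ → ℝ) :
    ∑ k ∈ Finset.range (n + 1),
      (if gridPoint T n k < s ∧ s ≤ gridPoint T n (k + 1) then u k else 0)
      = u (gridCell T n s) := by
  rw [Finset.sum_eq_single_of_mem _ (gridCell_mem_range n hs hT hsT), if_pos
    ⟨gridPoint_gridCell_lt n hs hT, le_gridPoint_gridCell_add_one n hs hT⟩]
  exact fun k _ hk => if_neg fun h => hk (eq_gridCell n hs hT h.1 h.2)

theorem tendsto_mul_one_div_add (T : ℝ≥0) :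
    Tendsto (fun n : ℕ => T * (1 / ((n : ℝ≥0) + 1))) atTop (𝓝 0) := by
  simpa using tendsto_const_nhds.mul (tendsto_one_div_add_atTop_nhds_zero_nat (𝕜 := ℝ≥0))

theorem tendsto_gridPoint_gridCell_add_one (hs : 0 < s) (hT : 0 < T) :
    Tendsto (fun n => gridPoint T n (gridCell T n s + 1)) atTop (𝓝[≥] s) := by
  have hle := fun n => le_gridPoint_gridCell_add_one n hs hT
  refine tendsto_nhdsWithin_iff.2 ⟨?_, Eventually.of_forall hle⟩
  refine tendsto_of_tendsto_of_tendsto_of_le_of_le tendsto_const_nhds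
    (h := fun n : ℕ => s + T * (1 / ((n : ℝ≥0) + 1))) ?_ hle fun n => ?_
  · simpa using tendsto_const_nhds.add (tendsto_mul_one_div_add T)
  · rw [gridPoint_succ]
    exact add_le_add (gridPoint_gridCell_lt n hs hT).le le_rfl

theorem eventually_le_gridPoint_gridCell (hs : 0 < s) (hT : 0 < T) {r : ℝ≥0} (hr : r < s) :
    ∀ᶠ n in atTop, r ≤ gridPoint T n (gridCell T n s) := by
  filter_upwards [(tendsto_mul_one_div_add T).eventually_lt_const (tsub_pos_of_lt hr)] with n hn
  have h := le_gridPoint_gridCell_add_one n hs hT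
  rw [gridPoint_succ] at h
  by_contra! hlt
  have h2 := add_lt_add hlt hn
  rw [add_tsub_cancel_of_le hr.le] at h2
  exact absurd h2 (not_lt.2 h)

/-- Step functions evaluated on the grid, and stopped at the time `r`, converge. -/
theorem tendsto_grid_stopped {v : ℝ≥0 → ℝ} (hs : 0 < s) (hT : 0 < T)
    (hv : ContinuousWithinAt v (Set.Ici s) s) (r : ℝ≥0) :
    Tendsto (fun n => if gridPoint T n (gridCell T n s) < r then
      v (gridPoint T n (gridCell T n s + 1)) else 0) atTop (𝓝 (if s ≤ r then v s else 0)) := by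
  -- If `s ≤ r`, the left end of the cell lies below `r` for every `n`; if `r < s`, it eventually
  -- passes `r`.
  split_ifs with h
  · refine (hv.tendsto.comp (tendsto_gridPoint_gridCell_add_one hs hT)).congr fun n => ?_
    rw [if_pos ((gridPoint_gridCell_lt n hs hT).trans_le h), Function.comp_apply]
  · refine tendsto_const_nhds.congr' ?_
    filter_upwards [eventually_le_gridPoint_gridCell hs hT (not_le.1 h)] with n hn
    rw [if_neg (not_lt.2 hn)]

end Grid

/-! ### Executions in the dark pool against a martingale -/

section Increments

variable {xhat q : ℝ} {y : ℕ → ℝ≥0∞} {τ : ℕ → ℝ≥0} {T : ℝ≥0}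

/-- The dark-pool executions during the `k`-th grid interval, provided that the order has not been
cancelled before. -/
def darkIncrement (xhat q : ℝ) (τ : ℕ → ℝ≥0) (y : ℕ → ℝ≥0∞) (r T : ℝ≥0) (n k : ℕ) : ℝ :=
  if gridPoint T n k < r then
    darkFilled xhat q τ y (gridPoint T n (k + 1)) - darkFilled xhat q τ y (gridPoint T n k)
  else 0

theorem darkIncrement_eq_sum (hτ : StrictMono τ) (ht : Tendsto τ atTop atTop) (r : ℝ≥0) (n : ℕ)
    {k : ℕ} (hk : k ∈ Finset.range (n + 1)) : darkIncrement xhat q τ y r T n k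
      = ∑ i ∈ Finset.range (arrivalCount τ T),
        if gridPoint T n k < τ i ∧ τ i ≤ gridPoint T n (k + 1) then
          (if gridPoint T n k < r then fill xhat q y i else 0) else 0 := by
  have hmono : gridPoint T n k ≤ gridPoint T n (k + 1) := gridPoint_mono n T k.le_succ
  have hle := gridPoint_le n T hk
  unfold darkIncrement
  split_ifs with h
  · rw [darkFilled, darkFilled, sum_arrivalCount_eq hτ ht hle,
      sum_arrivalCount_eq hτ ht (hmono.trans hle), ← Finset.sum_sub_distrib]
    refine Finset.sum_congr rfl fun i _ => ?_
    by_cases h1 : τ i ≤ gridPoint T n k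
    · simp [h1, h1.trans hmono]
    · simp [h1, not_le.1 h1]
  · simp

/-- Each arrival up to `T` lies in exactly one grid cell, so the total variation is at most the
total executed volume. -/
theorem sum_abs_darkIncrement_le (hτ : StrictMono τ) (ht : Tendsto τ atTop atTop)
    (hτ0 : 0 < τ 0) (hT : 0 < T) (r : ℝ≥0) (n : ℕ) :
    ∑ k ∈ Finset.range (n + 1), |darkIncrement xhat q τ y r T n k| ≤ |xhat| := by
  refine le_trans ?_ (sum_abs_fill_le xhat q y (arrivalCount τ T))
  calc ∑ k ∈ Finset.range (n + 1), |darkIncrement xhat q τ y r T n k|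
      ≤ ∑ k ∈ Finset.range (n + 1), ∑ i ∈ Finset.range (arrivalCount τ T),
        (if gridPoint T n k < τ i ∧ τ i ≤ gridPoint T n (k + 1) then |fill xhat q y i| else 0) := by
        refine Finset.sum_le_sum fun k hk => ?_
        rw [darkIncrement_eq_sum hτ ht r n hk]
        refine (Finset.abs_sum_le_sum_abs _ _).trans (Finset.sum_le_sum fun i _ => ?_)
        split_ifs <;> simp
    _ = ∑ i ∈ Finset.range (arrivalCount τ T), |fill xhat q y i| := by
        rw [Finset.sum_comm]
        refine Finset.sum_congr rfl fun i hi => ?_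
        exact sum_gridCell n (hτ0.trans_le (hτ.monotone i.zero_le)) hT
          ((lt_arrivalCount_iff hτ ht T i).1 (Finset.mem_range.1 hi)) fun _ => |fill xhat q y i|

theorem tendsto_sum_darkIncrement_mul (hτ : StrictMono τ) (ht : Tendsto τ atTop atTop)
    (hτ0 : 0 < τ 0) (hT : 0 < T) {r : ℝ≥0} (hr : r ≤ T) {v : ℝ≥0 → ℝ}
    (hv : ∀ s, ContinuousWithinAt v (Set.Ici s) s) :
    Tendsto (fun n => ∑ k ∈ Finset.range (n + 1),
        darkIncrement xhat q τ y r T n k * v (gridPoint T n (k + 1))) atTop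
      (𝓝 (∑ i ∈ Finset.range (arrivalCount τ r), fill xhat q y i * v (τ i))) := by
  have hpos : ∀ i, 0 < τ i := fun i => hτ0.trans_le (hτ.monotone i.zero_le)
  have h : ∀ n, ∑ k ∈ Finset.range (n + 1),
      darkIncrement xhat q τ y r T n k * v (gridPoint T n (k + 1))
      = ∑ i ∈ Finset.range (arrivalCount τ T), fill xhat q y i *
        (if gridPoint T n (gridCell T n (τ i)) < r then
          v (gridPoint T n (gridCell T n (τ i) + 1)) else 0) := fun n => by
    calc _ = ∑ k ∈ Finset.range (n + 1), ∑ i ∈ Finset.range (arrivalCount τ T),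
          (if gridPoint T n k < τ i ∧ τ i ≤ gridPoint T n (k + 1) then fill xhat q y i *
            (if gridPoint T n k < r then v (gridPoint T n (k + 1)) else 0) else 0) := by
          refine Finset.sum_congr rfl fun k hk => ?_
          rw [darkIncrement_eq_sum hτ ht r n hk, Finset.sum_mul]
          refine Finset.sum_congr rfl fun i _ => ?_
          split_ifs <;> simp
      _ = _ := by
          rw [Finset.sum_comm]
          refine Finset.sum_congr rfl fun i hi => ?_
          exact sum_gridCell n (hpos i) hT
            ((lt_arrivalCount_iff hτ ht T i).1 (Finset.mem_range.1 hi)) fun k =>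
              fill xhat q y i * (if gridPoint T n k < r then v (gridPoint T n (k + 1)) else 0)
  simp_rw [h]
  rw [sum_arrivalCount_eq hτ ht hr]
  refine tendsto_finsetSum _ fun i _ => ?_
  have h1 := (tendsto_grid_stopped (hpos i) hT (hv (τ i)) r).const_mul (fill xhat q y i)
  simpa only [mul_ite, mul_zero] using h1

end Increments

theorem darkFilled_stronglyMeasurable {Ω : Type*} [mΩ : MeasurableSpace Ω]
    (F : Filtration ℝ≥0 mΩ) {τ : ℕ → Ω → ℝ≥0} {y : ℕ → Ω → ℝ≥0∞} (hτ : ∀ i, Measurable (τ i))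
    (hy : ∀ i, Measurable (y i)) (xhat q : ℝ) (t : ℝ≥0) :
    StronglyMeasurable[tradingFiltration F τ y hτ hy xhat q t]
      (fun ω => darkFilled xhat q (fun i => τ i ω) (fun i => y i ω) t) := by
  refine @Measurable.stronglyMeasurable _ _ (_) _ _ _ _ _ _ ?_
  refine Measurable.mono (ma := rawTradingFiltration F τ y hτ hy xhat q t) ?_
    ((rawTradingFiltration F τ y hτ hy xhat q).le_rightCont t) le_rfl
  refine measurable_iff_comap_le.2 ?_
  change _ ≤ _ ⊔ _ ⊔ _
  exact le_sup_of_le_left (le_sup_of_le_right (le_iSup₂_of_le t le_rfl le_rfl))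

/-- Executions in a grid cell are valued at its right end, when they are known, and right-continuity
of the price recovers its value at the arrival. This replaces optional stopping at the arrival
times. -/
theorem dark_martingale_part {Ω : Type*} [mΩ : MeasurableSpace Ω] {P : Measure Ω}
    [IsFiniteMeasure P] {F : Filtration ℝ≥0 mΩ} {τ : ℕ → Ω → ℝ≥0} {y : ℕ → Ω → ℝ≥0∞}
    {hτm : ∀ i, Measurable (τ i)} {hym : ∀ i, Measurable (y i)} {xhat q : ℝ} {p : ℝ≥0 → Ω → ℝ}
    (hp : Martingale p (tradingFiltration F τ y hτm hym xhat q) P)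
    (hr : ∀ ω t, ContinuousWithinAt (fun s => p s ω) (Set.Ici t) t)
    (hτ0 : ∀ᵐ ω ∂P, 0 < τ 0 ω) (hτ : ∀ᵐ ω ∂P, StrictMono (fun i => τ i ω))
    (ht : ∀ᵐ ω ∂P, Tendsto (fun i => τ i ω) atTop atTop) {T : ℝ≥0} (hT : 0 < T) {ρ : Ω → ℝ≥0}
    (hρ : IsStoppingTime (tradingFiltration F τ y hτm hym xhat q) fun ω => (ρ ω : WithTop ℝ≥0))
    (hρT : ∀ᵐ ω ∂P, ρ ω < T) :
    Integrable (fun ω => ∑ i ∈ Finset.range (arrivalCount (fun i => τ i ω) (ρ ω)),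
      fill xhat q (fun j => y j ω) i * p (τ i ω) ω) P ∧
    Integrable (fun ω => darkFilled xhat q (fun i => τ i ω) (fun i => y i ω) (ρ ω) * p T ω) P ∧
    ∫ ω, ∑ i ∈ Finset.range (arrivalCount (fun i => τ i ω) (ρ ω)),
        fill xhat q (fun j => y j ω) i * p (τ i ω) ω ∂P
      = ∫ ω, darkFilled xhat q (fun i => τ i ω) (fun i => y i ω) (ρ ω) * p T ω ∂P := by
  refine martingale_riemann_limit hp (s := fun n k => gridPoint T n (k + 1))
    (W := fun n k ω => darkIncrement xhat q (fun i => τ i ω) (fun i => y i ω) (ρ ω) T n k)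
    (B := |xhat|) (fun n k hk => gridPoint_le n T hk) (fun n k => ?_) (abs_nonneg _)
    (fun n => ?_) ?_ ?_
  · have hmono : gridPoint T n k ≤ gridPoint T n (k + 1) := gridPoint_mono n T k.le_succ
    refine StronglyMeasurable.ite ?_ ((darkFilled_stronglyMeasurable F hτm hym xhat q _).sub
      ((darkFilled_stronglyMeasurable F hτm hym xhat q _).mono (Filtration.mono _ hmono)))
      stronglyMeasurable_const
    -- Cancellation is tested at the left end of the cell, so the event `gridPoint T n k < ρ` is
    -- already known at the right end.
    have := (Filtration.mono _ hmono) _ (hρ.measurableSet_gt (gridPoint T n k))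
    simpa only [WithTop.coe_lt_coe] using this
  · filter_upwards [hτ0, hτ, ht] with ω h0 h1 h2
    exact sum_abs_darkIncrement_le h1 h2 h0 hT _ n
  · filter_upwards [hτ0, hτ, ht, hρT] with ω h0 h1 h2 h3
    exact tendsto_sum_darkIncrement_mul h1 h2 h0 hT h3.le (hr ω)
  · filter_upwards [hτ0, hτ, ht, hρT] with ω h0 h1 h2 h3
    -- The constant price `1` turns the same limit into the total execution `Z_ρ`.
    simpa only [mul_one, darkFilled] using
      tendsto_sum_darkIncrement_mul (v := fun _ => 1) h1 h2 h0 hT h3.le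
        fun _ => continuousWithinAt_const

/-! ### Lower bounds for extended integrals -/

/-- An integrable minorant bounds the negative part, which excludes `∞ - ∞`. -/
theorem le_extIntegral {α : Type*} [MeasurableSpace α] {μ : Measure α} {f : α → EReal} {g : α → ℝ}
    (hg : Integrable g μ) (h : ∀ᵐ x ∂μ, (g x : EReal) ≤ f x) :
    HasExtIntegral μ f ∧ ((∫ x, g x ∂μ : ℝ) : EReal) ≤ extIntegral μ f := by
  have hpos : ∫⁻ x, ENNReal.ofReal (g x) ∂μ ≤ ∫⁻ x, (f x).toENNReal ∂μ :=
    lintegral_mono_ae (h.mono fun x hx => by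
      rw [← EReal.real_coe_toENNReal]
      exact EReal.toENNReal_le_toENNReal hx)
  have hneg : ∫⁻ x, (-f x).toENNReal ∂μ ≤ ∫⁻ x, ENNReal.ofReal (-g x) ∂μ :=
    lintegral_mono_ae (h.mono fun x hx => by
      rw [← EReal.real_coe_toENNReal, EReal.coe_neg]
      exact EReal.toENNReal_le_toENNReal (EReal.neg_le_neg_iff.2 hx))
  have hp : ∫⁻ x, ENNReal.ofReal (g x) ∂μ ≠ ∞ :=
    ((lintegral_mono fun x => Real.ofReal_le_enorm (g x)).trans_lt hg.2).ne
  have hn : ∫⁻ x, ENNReal.ofReal (-g x) ∂μ ≠ ∞ :=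
    ((lintegral_mono fun x => Real.ofReal_le_enorm (-g x)).trans_lt hg.neg.2).ne
  refine ⟨Or.inr (hneg.trans_lt hn.lt_top).ne, ?_⟩
  rw [integral_eq_lintegral_pos_part_sub_lintegral_neg_part hg, EReal.coe_sub,
    EReal.coe_ennreal_toReal hp, EReal.coe_ennreal_toReal hn]
  exact EReal.sub_le_sub (EReal.coe_ennreal_le_coe_ennreal_iff.2 hpos)
    (EReal.coe_ennreal_le_coe_ennreal_iff.2 hneg)

/-! ### One-sided strategies -/

/-- The sign `ε` treats buying (`ε = 1`) and selling (`ε = -1`) together. -/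
theorem mul_nonneg_of_sign {ε a b : ℝ} (hε : ε = 1 ∨ ε = -1) (ha : 0 ≤ ε * a) (hb : 0 ≤ ε * b) :
    0 ≤ a * b := by
  rcases hε with rfl | rfl <;> nlinarith

theorem IsImpactFunction.mul_nonneg_of_sign {h : ℝ → ℝ} (hh : IsImpactFunction h) {ε x : ℝ}
    (hε : ε = 1 ∨ ε = -1) (hx : 0 ≤ ε * x) : 0 ≤ ε * h x := by
  rcases hε with rfl | rfl
  · have := hh.strictMono.monotone (show 0 ≤ x by linarith)
    rw [hh.map_zero] at this
    linarith
  · have := hh.strictMono.monotone (show x ≤ 0 by linarith)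
    rw [hh.map_zero] at this
    linarith

theorem measurable_uncurry_of_isStronglyPredictable {Ω : Type*} [mΩ : MeasurableSpace Ω]
    {G : Filtration ℝ≥0 mΩ} {ξ : ℝ≥0 → Ω → ℝ} (hξ : IsStronglyPredictable G ξ) :
    Measurable (Function.uncurry ξ) := by
  refine (StronglyMeasurable.mono hξ ?_).measurable
  exact measurableSpace_le_predictable_of_measurableSet
    (fun A hA => (measurableSet_singleton _).prod (G.le _ A hA))
    fun i A hA => measurableSet_Ioi.prod (G.le i A hA)

theorem Strategy.mul_exchangeTraded_nonneg {Ω : Type*} {χ : Strategy Ω} {ε : ℝ} {T t : ℝ≥0} {ω : Ω}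
    (hξ : ∀ s ≤ T, 0 ≤ ε * χ.ξ s ω) (ht : t ≤ T) : 0 ≤ ε * χ.exchangeTraded t ω := by
  rw [Strategy.exchangeTraded, ← intervalIntegral.integral_const_mul]
  refine intervalIntegral.integral_nonneg t.coe_nonneg fun s hs => hξ _ ?_
  exact (Real.toNNReal_le_iff_le_coe.2 hs.2).trans ht

/-- Trades of one sign do not cancel, so the net amount traded equals the total variation. -/
theorem Strategy.lintegral_enorm_le {Ω : Type*} {χ : Strategy Ω} {ε : ℝ} (hε : ε = 1 ∨ ε = -1)
    {T : ℝ≥0} {ω : Ω} (hξ : ∀ s ≤ T, 0 ≤ ε * χ.ξ s ω)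
    (hi : IntervalIntegrable (fun s : ℝ => χ.ξ s.toNNReal ω) volume 0 T) {C : ℝ}
    (hC : |χ.exchangeTraded T ω| ≤ C) :
    ∫⁻ t in Set.Ioc (0 : ℝ) T, ‖χ.ξ t.toNNReal ω‖ₑ ≤ ENNReal.ofReal C := by
  have habs : |ε| = 1 := by rcases hε with rfl | rfl <;> simp
  have hnn : ∀ᵐ t ∂volume.restrict (Set.Ioc (0 : ℝ) T), 0 ≤ ε * χ.ξ t.toNNReal ω := by
    filter_upwards [ae_restrict_mem measurableSet_Ioc] with t ht
    exact hξ _ (Real.toNNReal_le_iff_le_coe.2 ht.2)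
  calc ∫⁻ t in Set.Ioc (0 : ℝ) T, ‖χ.ξ t.toNNReal ω‖ₑ
      = ∫⁻ t in Set.Ioc (0 : ℝ) T, ENNReal.ofReal (ε * χ.ξ t.toNNReal ω) := by
        refine lintegral_congr_ae (hnn.mono fun t ht => ?_)
        simp only
        rw [Real.enorm_eq_ofReal_abs, ← abs_of_nonneg ht, abs_mul, habs, one_mul]
    _ = ENNReal.ofReal (ε * χ.exchangeTraded T ω) := by
        rw [Strategy.exchangeTraded, intervalIntegral.integral_of_le T.coe_nonneg,
          ← integral_const_mul, ofReal_integral_eq_lintegral_ofReal (hi.1.const_mul ε) hnn]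
    _ ≤ ENNReal.ofReal C := by
        refine ENNReal.ofReal_le_ofReal (le_trans (le_abs_self _) ?_)
        rwa [abs_mul, habs, one_mul]

namespace DarkPoolModel

variable {Ω : Type*} [mΩ : MeasurableSpace Ω] {P : Measure Ω}

/-- The costs of `χ` without any price impact. -/
def unaffectedCost (M : DarkPoolModel Ω P) (X₀ : ℝ) (T : ℝ≥0) (χ : Strategy Ω) (ω : Ω) : ℝ :=
  X₀ * M.price 0 ω + (∫ t in Set.Ioc (0 : ℝ) T, χ.ξ t.toNNReal ω * M.price t.toNNReal ω)
    + ∑ i ∈ Finset.range (M.N (χ.ρ ω) ω), M.Y χ i ω * M.price (M.τ i ω) ω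

/-- The costs of a one-sided strategy are at least its costs without price impact. -/
theorem unaffectedCost_le_cost (M : DarkPoolModel Ω P) (X₀ : ℝ) {T : ℝ≥0} {χ : Strategy Ω} {ε : ℝ}
    (hε : ε = 1 ∨ ε = -1) (hx : 0 ≤ ε * χ.xhat) {ω : Ω} (hξ : ∀ t ≤ T, 0 ≤ ε * χ.ξ t ω)
    (hi : IntegrableOn (fun t : ℝ => χ.ξ t.toNNReal ω * M.price t.toNNReal ω) (Set.Ioc 0 T))
    (hρ : χ.ρ ω ≤ T) (hτ : StrictMono fun i => M.τ i ω)
    (ht : Tendsto (fun i => M.τ i ω) atTop atTop) :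
    (M.unaffectedCost X₀ T χ ω : EReal) ≤ M.cost X₀ T χ ω := by
  have hex : ∀ t ≤ T, 0 ≤ ε * χ.exchangeTraded t ω := fun t =>
    Strategy.mul_exchangeTraded_nonneg hξ
  have hZ : ∀ t, 0 ≤ ε * M.Z χ t ω := fun t => mul_darkFilled_nonneg hx _ _ _ t
  have hY : ∀ i, 0 ≤ ε * M.Y χ i ω := fun i => mul_fill_nonneg hx _ _ i
  have h1 : ((∫ t in Set.Ioc (0 : ℝ) T, χ.ξ t.toNNReal ω * M.price t.toNNReal ω : ℝ) : EReal)
      ≤ extIntegral (volume.restrict (Set.Ioc (0 : ℝ) T))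
        (fun t => ((χ.ξ t.toNNReal ω * M.exchangePrice χ t.toNNReal ω : ℝ) : EReal)) := by
    refine (le_extIntegral hi ?_).2
    filter_upwards [ae_restrict_mem measurableSet_Ioc] with t ht
    have htT : t.toNNReal ≤ T := Real.toNNReal_le_iff_le_coe.2 ht.2
    have ha := mul_nonneg M.γ_pos.le (mul_nonneg_of_sign hε (hξ _ htT) (hex _ htT))
    have hb := mul_nonneg_of_sign hε (hξ _ htT) (M.h_impact.mul_nonneg_of_sign hε (hξ _ htT))
    refine EReal.coe_le_coe_iff.2 ?_
    rw [exchangePrice]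
    linarith
  have h2 : 0 ≤ M.α * M.γ * ∫ t in (0 : ℝ)..(T : ℝ),
      M.Z χ (min (χ.ρ ω) t.toNNReal) ω * χ.ξ t.toNNReal ω := by
    -- No integrability is needed: the Bochner integral of a nonnegative function is nonnegative,
    -- the default `0` included.
    refine mul_nonneg (mul_nonneg M.α_nonneg M.γ_pos.le)
      (intervalIntegral.integral_nonneg T.coe_nonneg fun t ht => ?_)
    exact mul_nonneg_of_sign hε (hZ _) (hξ _ (Real.toNNReal_le_iff_le_coe.2 ht.2))
  have h3 : ∑ i ∈ Finset.range (M.N (χ.ρ ω) ω), M.Y χ i ω * M.price (M.τ i ω) ω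
      ≤ ∑ i ∈ Finset.range (M.N (χ.ρ ω) ω), M.Y χ i ω *
        (M.darkPrice χ i ω
          + M.α * M.γ * Function.leftLim (fun t => M.Z χ t ω) (M.τ i ω)
          + M.β (M.Y χ i ω)) := by
    refine Finset.sum_le_sum fun i hmem => ?_
    have hiT : M.τ i ω ≤ T :=
      ((lt_arrivalCount_iff hτ ht _ i).1 (Finset.mem_range.1 hmem)).trans hρ
    have ha := mul_nonneg M.γ_pos.le (mul_nonneg_of_sign hε (hY i) (hex _ hiT))
    have hb := mul_nonneg M.κ_nonneg
      (mul_nonneg_of_sign hε (hY i) (M.h_impact.mul_nonneg_of_sign hε (hξ _ hiT)))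
    have hc := mul_nonneg (mul_nonneg M.α_nonneg M.γ_pos.le)
      (mul_nonneg_of_sign hε (hY i) (mul_leftLim_nonneg hZ (M.τ i ω)))
    have hd := mul_nonneg_of_sign hε (hY i) (M.β_impact.mul_nonneg_of_sign hε (hY i))
    rw [darkPrice]
    linarith
  calc (M.unaffectedCost X₀ T χ ω : EReal)
      = ((X₀ * M.price 0 ω : ℝ) : EReal)
        + ((∫ t in Set.Ioc (0 : ℝ) T, χ.ξ t.toNNReal ω * M.price t.toNNReal ω : ℝ) : EReal)
        + ((0 : ℝ) : EReal)
        + ((∑ i ∈ Finset.range (M.N (χ.ρ ω) ω), M.Y χ i ω * M.price (M.τ i ω) ω : ℝ) : EReal) := by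
        rw [unaffectedCost, EReal.coe_zero, add_zero, ← EReal.coe_add, ← EReal.coe_add]
    _ ≤ M.cost X₀ T χ ω :=
        add_le_add (add_le_add (add_le_add le_rfl h1) (EReal.coe_le_coe_iff.2 h2))
          (EReal.coe_le_coe_iff.2 h3)

/-- A strategy that only sells (`ε = -1`) or only buys (`ε = 1`) has nonnegative expected costs. -/
theorem expectedCost_nonneg_of_sign [IsProbabilityMeasure P] (M : DarkPoolModel Ω P) {X₀ : ℝ}
    {T : ℝ≥0} {χ : Strategy Ω} (hT : 0 < T) (hχ : M.IsAdmissible X₀ T χ) {ε : ℝ}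
    (hε : ε = 1 ∨ ε = -1) (hx : 0 ≤ ε * χ.xhat)
    (hξ : ∀ᵐ ω ∂P, ∀ t ≤ T, 0 ≤ ε * χ.ξ t ω) :
    M.HasExpectedCost X₀ T χ ∧ 0 ≤ M.expectedCost X₀ T χ := by
  have hp := M.price_martingale_trading χ.xhat χ.q hχ.q_nonneg hχ.q_le
  obtain ⟨C, hC⟩ := hχ.bounded
  have hb : ∀ᵐ ω ∂P, ∫⁻ t in Set.Ioc (0 : ℝ) T, ‖χ.ξ t.toNNReal ω‖ₑ ≤ ENNReal.ofReal C := by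
    filter_upwards [hξ, hχ.integrable, hC] with ω h1 h2 h3
    exact Strategy.lintegral_enorm_le hε h1 h2 (h3 T le_rfl)
  obtain ⟨he1, he2, he3, he4⟩ := exchange_martingale_part hp M.price_rightCont
    hχ.predictable.stronglyAdapted (measurable_uncurry_of_isStronglyPredictable hχ.predictable)
    T C hb
  obtain ⟨hd1, hd2, hd3⟩ := dark_martingale_part hp M.price_rightCont M.τ_pos M.τ_strictMono
    M.τ_tendsto hT hχ.stopping hχ.ρ_lt
  have h0 := (hp.integrable 0).const_mul X₀
  have hT0 := (hp.integrable T).const_mul X₀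
  have hint : Integrable (M.unaffectedCost X₀ T χ) P := (h0.add he2).add hd1
  have hzero : ∫ ω, M.unaffectedCost X₀ T χ ω ∂P = 0 := by
    have hprice : ∫ ω, X₀ * M.price 0 ω ∂P = ∫ ω, X₀ * M.price T ω ∂P := by
      rw [integral_const_mul, integral_const_mul]
      congr 1
      simpa using hp.setIntegral_eq T.2 MeasurableSet.univ
    calc ∫ ω, M.unaffectedCost X₀ T χ ω ∂P
        = ∫ ω, X₀ * M.price 0 ω ∂P
          + ∫ ω, (∫ t in Set.Ioc (0 : ℝ) T, χ.ξ t.toNNReal ω * M.price t.toNNReal ω) ∂P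
          + ∫ ω, ∑ i ∈ Finset.range (M.N (χ.ρ ω) ω), M.Y χ i ω * M.price (M.τ i ω) ω ∂P :=
          (integral_add (h0.add he2) hd1).trans (congrArg (· + _) (integral_add h0 he2))
      _ = ∫ ω, X₀ * M.price T ω ∂P
          + ∫ ω, (∫ t in Set.Ioc (0 : ℝ) T, χ.ξ t.toNNReal ω) * M.price T ω ∂P
          + ∫ ω, M.Z χ (χ.ρ ω) ω * M.price T ω ∂P := by
          rw [hprice, he4]
          exact congrArg (_ + ·) hd3
      _ = ∫ ω, (X₀ * M.price T ω + (∫ t in Set.Ioc (0 : ℝ) T, χ.ξ t.toNNReal ω) * M.price T ω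
          + M.Z χ (χ.ρ ω) ω * M.price T ω) ∂P :=
          ((integral_add (hT0.add he3) hd2).trans
            (congrArg (· + _) (integral_add hT0 he3))).symm
      _ = ∫ _, (0 : ℝ) ∂P := by
          -- After revaluation at `T`, the price multiplies exactly the expression that the
          -- liquidation constraint sets to `0`.
          refine integral_congr_ae (hχ.liquidation.mono fun ω hω => ?_)
          rw [Strategy.exchangeTraded, intervalIntegral.integral_of_le T.coe_nonneg] at hω
          simp only
          rw [← add_mul, ← add_mul, hω, zero_mul]
      _ = 0 := integral_zero _ _
  have hle : ∀ᵐ ω ∂P, (M.unaffectedCost X₀ T χ ω : EReal) ≤ M.cost X₀ T χ ω := by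
    filter_upwards [hξ, he1, hχ.ρ_lt, M.τ_strictMono, M.τ_tendsto] with ω h1 h2 h3 h4 h5
    exact M.unaffectedCost_le_cost X₀ hε hx h1 h2 h3.le h4 h5
  have h := le_extIntegral hint hle
  rw [hzero, EReal.coe_zero] at h
  exact h

theorem expectedCost_nonneg_of_isSellOnly [IsProbabilityMeasure P] (M : DarkPoolModel Ω P) {X₀ : ℝ}
    {T : ℝ≥0} {χ : Strategy Ω} (hT : 0 < T) (hχ : M.IsAdmissible X₀ T χ)
    (h : IsSellOnly P T χ) : M.HasExpectedCost X₀ T χ ∧ 0 ≤ M.expectedCost X₀ T χ :=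
  M.expectedCost_nonneg_of_sign hT hχ (Or.inr rfl) (by linarith [h.1])
    (h.2.mono fun ω hω t ht => by linarith [hω t ht])

theorem expectedCost_nonneg_of_isBuyOnly [IsProbabilityMeasure P] (M : DarkPoolModel Ω P) {X₀ : ℝ}
    {T : ℝ≥0} {χ : Strategy Ω} (hT : 0 < T) (hχ : M.IsAdmissible X₀ T χ)
    (h : IsBuyOnly P T χ) : M.HasExpectedCost X₀ T χ ∧ 0 ≤ M.expectedCost X₀ T χ :=
  M.expectedCost_nonneg_of_sign hT hχ (Or.inl rfl) (by linarith [h.1])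
    (h.2.mono fun ω hω t ht => by linarith [hω t ht])

end DarkPoolModel

end

/-! ### From negative expected costs to manipulation -/

theorem mainTheorem4 {Ω : Type*} [MeasurableSpace Ω] (P : Measure Ω) [IsProbabilityMeasure P]
    (M : DarkPoolModel Ω P) :
    (¬ M.TransactionTriggeredPriceManipulation → M.NonnegExpectedLiquidationCosts) ∧
    (M.NonnegExpectedLiquidationCosts → ¬ M.PriceManipulation) := by
  refine ⟨fun hno X₀ T χ hT hχ hcost => ?_, fun h ⟨T, χ, hT, hχ, hcost, hneg⟩ =>
    absurd (h 0 T χ hT hχ hcost) (not_le.2 hneg)⟩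
  by_contra! hneg
  refine hno ⟨X₀, T, χ, hT, hχ, hcost, ?_⟩
  rcases le_total 0 X₀ with hX | hX
  · refine Or.inl ⟨hX, ?_, fun χ' hχ' hs => ?_⟩
    -- The negated disjunction is precisely `IsSellOnly`, which would force nonnegative expected
    -- costs.
    · by_contra! hs
      exact absurd (M.expectedCost_nonneg_of_isSellOnly hT hχ hs).2 (not_le.2 hneg)
    · have h := M.expectedCost_nonneg_of_isSellOnly hT hχ' hs
      exact ⟨hcost, h.1, hneg.trans_le h.2⟩
  · refine Or.inr ⟨hX, ?_, fun χ' hχ' hs => ?_⟩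
    · by_contra! hs
      exact absurd (M.expectedCost_nonneg_of_isBuyOnly hT hχ hs).2 (not_le.2 hneg)
    · have h := M.expectedCost_nonneg_of_isBuyOnly hT hχ' hs
      exact ⟨hcost, h.1, hneg.trans_le h.2⟩
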